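/- **Setting.** For every sample size $n$ let $p=p_n$ and let $(X^i,Y^i)$, $1\le i\le n$, be independent copies of a pair $(X,Y)$, $X\in\mathbb R^{p}$, $Y\in\{1,-1\}$, that follows a semiparametric LDA model: there are univariate functions $h_1,\dots,h_p$, with $h_j$ strictly increasing on a Borel set that carries $X_j$, such that conditionally on $Y=\pm1$ the vector $h(X)=(h_1(X_1),\dots,h_p(X_p))$ is $N(\mu_{\pm},\Sigma)$, with $\Sigma$ positive definite, normalized by $\mu_+=0$ and $\Sigma_{jj}=1$. All these objects may depend on $n$. Put $\pi_\pm=\Pr(Y=\pm1)$, $\Omega=\mathrm{Cov}\{h(X)\}$, $\beta^{\mathrm{Bayes}}=\Sigma^{-1}(\mu_+-\mu_-)$, $\beta=\Omega^{-1}(\mu_+-\mu_-)$, $A=\{j:\beta^{\mathrm{Bayes}}_j\ne0\}$ (assumed non-empty), $s=|A|$, and $$\kappa_n=\|\Omega_{A^cA}(\Omega_{AA})^{-1}\|_\infty,\qquad \varphi=\|(\Omega_{AA})^{-1}\|_\infty,\qquad \Delta=\|\mu_{+A}-\mu_{-A}\|_\infty,$$ where $\|M\|_\infty$ is the largest absolute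 row sum of a matrix and the sup norm of a vector. **Estimator.** Let $n_\pm=\#\{i:Y^i=\pm1\}$, let $\tilde F_{+j}$ be the empirical distribution function of the $j$th feature in the class $+1$, let $\hat F_{+j}$ be $\tilde F_{+j}$ Winsorized at $(1/n_+^2,\,1-1/n_+^2)$, and $\hat h_j=\Phi^{-1}\circ\hat F_{+j}$, where $\Phi$ is the standard normal distribution function. For a numeric coding $R^i$ of the labels, the SSDA estimator $(\hat\beta_0,\hat\beta)$ with parameter $\lambda_n>0$ is any minimizer over $(b_0,b)\in\mathbb R\times\mathbb R^p$ of $$n^{-1}\sum_{i=1}^n\{R^i-b_0-\hat h(X^i)^{T}b\}^2+\lambda_n\sum_{j=1}^p|b_j| .$$ Let $\hat A=\{j:\hat\beta_j\neq0\}$. **Theorem.** Assume that $\pi_+,\pi_-$ are bounded away from $0$, that $\varphi$ and $\Delta$ are bounded and that $\kappa_n\le\kappa$ for a constant $\kappa<1$. Let $0<\rho<1/3$ and assume (C1) $n,p\to\infty$ and $s^2\log(ps)/n^{1/3-\rho}\to0$; (C2) $\min_{j\in A}|\beta_j|\gg\max\left[s\,n^{-\rho/2},\; s\{\log(ps)/n^{1/3-\rho}\}^{1/2}\right]$.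 If $\lambda_n\ll\min_{j\in A}|\beta_j|$ and $\lambda_n\gg s\{\log(ps)/n^{1/3-\rho}\}^{1/2}$, then, as $n\to\infty$, 1. for the centered coding $R^i=n/n_+$ if $Y^i=1$ and $R^i=-n/n_-$ if $Y^i=-1$: $\;\Pr(\hat A=A)\to1$ and $\Pr(\|\hat\beta_A-\beta_A\|_\infty\le4\varphi\lambda_n)\to1$; 2. for the coding $R^i=Y^i$: $\;\Pr(\hat A=A)\to1$ and $\Pr(\|\hat\beta_A-2\pi_+\pi_-\beta_A\|_\infty\le4\varphi\lambda_n)\to1$. -/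

import Mathlib

open MeasureTheory ProbabilityTheory Filter Topology Asymptotics

noncomputable section

/-- The standard normal quantile function `Φ⁻¹` (used only at arguments in `(0, 1)`). -/
def stdNormalQuantile (u : ℝ) : ℝ := sInf {x : ℝ | u ≤ cdf (gaussianReal 0 1) x}

/-- The matrix norm `‖M‖_∞`, the largest absolute row sum (`0` if there are no rows). -/
def maxRowSum {m₁ m₂ : Type*} [Fintype m₂] (M : Matrix m₁ m₂ ℝ) : ℝ :=
  ⨆ i, ∑ j, |M i j|

/-- The semiparametric LDA model in dimension `p`: `law` is the joint law of a pair `(X, Y)` with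
`Y ∈ {1, -1}`, and conditionally on `Y = y` the vector `(h₁(X₁), …, h_p(X_p))` is `N(μ_y, Σ)`,
with the normalization `μ₊ = 0` and `Σ_jj = 1`. Each `h_j` is strictly increasing on a set that
carries `X_j` (the whole line, or for instance `(0, ∞)` for a positive feature). -/
structure SeLDAModel (p : ℕ) where
  law : Measure ((Fin p → ℝ) × ℝ)
  h : Fin p → ℝ → ℝ
  muPlus : EuclideanSpace ℝ (Fin p)
  muMinus : EuclideanSpace ℝ (Fin p)
  Sigma : Matrix (Fin p) (Fin p) ℝ
  isProb : IsProbabilityMeasure law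
  label : ∀ᵐ z ∂law, z.2 = 1 ∨ z.2 = -1
  pos_plus : law {z | z.2 = 1} ≠ 0
  pos_minus : law {z | z.2 = -1} ≠ 0
  strictMono_h : ∀ j, ∃ T : Set ℝ, MeasurableSet T ∧ (∀ᵐ z ∂law, z.1 j ∈ T) ∧
    StrictMonoOn (h j) T
  posDef : Sigma.PosDef
  law_plus : HasLaw (fun z : (Fin p → ℝ) × ℝ => WithLp.toLp 2 (fun j => h j (z.1 j)))
    (multivariateGaussian muPlus Sigma) (law[|{z | z.2 = 1}])
  law_minus : HasLaw (fun z : (Fin p → ℝ) × ℝ => WithLp.toLp 2 (fun j => h j (z.1 j)))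
    (multivariateGaussian muMinus Sigma) (law[|{z | z.2 = -1}])
  muPlus_eq : muPlus = 0
  Sigma_diag : ∀ j, Sigma j j = 1

namespace SeLDAModel

variable {p : ℕ} (M : SeLDAModel p)

/-- `π₊`. -/
def piPlus : ℝ := M.law.real {z | z.2 = 1}

/-- `π₋`. -/
def piMinus : ℝ := M.law.real {z | z.2 = -1}

/-- `μ₊ - μ₋`. -/
def delta (j : Fin p) : ℝ := M.muPlus j - M.muMinus j

/-- `Ω`, the (unconditional) covariance matrix of `h(X)`. -/
def Omega : Matrix (Fin p) (Fin p) ℝ :=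
  Matrix.of fun j k => cov[fun z => M.h j (z.1 j), fun z => M.h k (z.1 k); M.law]

/-- The Bayes rule direction `Σ⁻¹ (μ₊ - μ₋)`. -/
def betaBayes : Fin p → ℝ := Matrix.mulVec M.Sigma⁻¹ M.delta

/-- `β⋆ = Ω⁻¹ (μ₊ - μ₋)`. -/
def betaStar : Fin p → ℝ := Matrix.mulVec M.Omega⁻¹ M.delta

/-- The set `A` of the features that are relevant for the Bayes rule. -/
def A : Finset (Fin p) := Finset.univ.filter fun j => M.betaBayes j ≠ 0

/-- `s = |A|`. -/
def s : ℕ := M.A.card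

/-- `Ω_AA`. -/
def OmegaAA : Matrix {j // j ∈ M.A} {j // j ∈ M.A} ℝ :=
  M.Omega.submatrix Subtype.val Subtype.val

/-- `Ω_{Aᶜ A}`. -/
def OmegaAcA : Matrix {j // j ∉ M.A} {j // j ∈ M.A} ℝ :=
  M.Omega.submatrix Subtype.val Subtype.val

/-- `κ = ‖Ω_{Aᶜ A} (Ω_AA)⁻¹‖_∞`. -/
def kappa : ℝ := maxRowSum (M.OmegaAcA * M.OmegaAA⁻¹)

/-- `φ = ‖(Ω_AA)⁻¹‖_∞`. -/
def varphi : ℝ := maxRowSum M.OmegaAA⁻¹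

/-- `Δ = ‖μ_{+A} - μ_{-A}‖_∞` (the norm of a finite product of copies of `ℝ` is the sup norm). -/
def Delta : ℝ := ‖fun j : {j // j ∈ M.A} => M.delta j‖

/-- `min_{j ∈ A} |β⋆_j|`. -/
def minBeta : ℝ := ⨅ j : {j // j ∈ M.A}, |M.betaStar j|

end SeLDAModel

/-- `n₊`, the number of observations with label `1`. -/
def nPlus {n : ℕ} (Y : Fin n → ℝ) : ℕ := (Finset.univ.filter fun i => Y i = 1).card

/-- `n₋`, the number of observations with label `-1`. -/
def nMinus {n : ℕ} (Y : Fin n → ℝ) : ℕ := (Finset.univ.filter fun i => Y i = -1).card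

/-- The empirical CDF of the `j`th feature within the class `+1`. -/
def empCDFPlus {n p : ℕ} (X : Fin n → Fin p → ℝ) (Y : Fin n → ℝ) (j : Fin p) (x : ℝ) : ℝ :=
  ((Finset.univ.filter fun i => Y i = 1 ∧ X i j ≤ x).card : ℝ) / (nPlus Y : ℝ)

/-- The empirical CDF of the class `+1`, Winsorized at `(1 / n₊², 1 - 1 / n₊²)`. -/
def winsorCDFPlus {n p : ℕ} (X : Fin n → Fin p → ℝ) (Y : Fin n → ℝ) (j : Fin p) (x : ℝ) : ℝ :=
  if empCDFPlus X Y j x > 1 - 1 / (nPlus Y : ℝ) ^ 2 then 1 - 1 / (nPlus Y : ℝ) ^ 2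
  else if empCDFPlus X Y j x < 1 / (nPlus Y : ℝ) ^ 2 then 1 / (nPlus Y : ℝ) ^ 2
  else empCDFPlus X Y j x

/-- The (naive) estimator `ĥ_j = Φ⁻¹ ∘ F̂_{+j}` of the `j`th transformation. -/
def hHat {n p : ℕ} (X : Fin n → Fin p → ℝ) (Y : Fin n → ℝ) (j : Fin p) (x : ℝ) : ℝ :=
  stdNormalQuantile (winsorCDFPlus X Y j x)

/-- The lasso criterion on the pseudo data, with numeric response `R`:
`n⁻¹ ∑ᵢ (Rᵢ - b₀ - ĥ(Xᵢ)ᵀ b)² + ∑ⱼ lam |bⱼ|`. -/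
def ssdaCriterion {n p : ℕ} (X : Fin n → Fin p → ℝ) (Y R : Fin n → ℝ) (lam : ℝ)
    (b0 : ℝ) (b : Fin p → ℝ) : ℝ :=
  (n : ℝ)⁻¹ * ∑ i, (R i - b0 - ∑ j, hHat X Y j (X i j) * b j) ^ 2 + ∑ j, lam * |b j|

/-- `(b0, b)` is a minimizer of the lasso criterion. -/
def IsSSDA {n p : ℕ} (X : Fin n → Fin p → ℝ) (Y R : Fin n → ℝ) (lam : ℝ)
    (b0 : ℝ) (b : Fin p → ℝ) : Prop :=
  ∀ (c0 : ℝ) (c : Fin p → ℝ), ssdaCriterion X Y R lam b0 b ≤ ssdaCriterion X Y R lam c0 c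

/-- The centered numeric coding of the labels: `n / n₊` in the class `+1`, and `-n / n₋` in the
class `-1`. The population least squares coefficient for it is `β⋆`. -/
def centeredLabels {n : ℕ} (Y : Fin n → ℝ) (i : Fin n) : ℝ :=
  if Y i = 1 then (n : ℝ) / (nPlus Y : ℝ) else -((n : ℝ) / (nMinus Y : ℝ))

/-- The set `{j : b_j ≠ 0}` of the selected features. -/
def selected {p : ℕ} (b : Fin p → ℝ) : Finset (Fin p) := Finset.univ.filter fun j => b j ≠ 0

end

/-! The proof separates a deterministic statement about the lasso from a uniform bound on sample
covariances. Write `δ = μ₊ - μ₋`. Once the intercept is profiled out, the minimizers depend on the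
data only through the sample covariances of the estimated scores with each other and with the
response. It suffices that, with high probability, these are entrywise within `e` of `Ω` and of `a
δ` (`a = 1` or `a = 2 π₊ π₋`), where `s e` is small and also small compared with `λ`.

Deterministic part. Since `Ω = Σ + π₊ π₋ δ δᵀ`, the vector `β = Ω⁻¹ δ` is a multiple of the Bayes
direction, hence vanishes off `A` (`betaStar_eq_smul`). Solve the stationarity equations on `A` with
the signs frozen at those of `a β`. The bound `φ` on the inverse active block keeps the solution
within `2 φ λ` of `a β`, less than every `|a β_j|` on `A`, so the frozen signs are the right ones.
Off `A` the irrepresentability bound `κ < 1` keeps the gradient strictly below the threshold. A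
vector with such a strict certificate equals every minimizer (`exists_lasso_certificate`,
`lasso_eq_of_certificate`, `IsSSDA.selected_eq`).

Statistical part. The estimated scores depend only on the order of each feature, so the features may
be replaced by `z_j = h_j(X_j)`, which is standard normal in the class `1`. Cut at `B = √(log n /
2)`. On `[-B, B]`, Hoeffding's inequality on a grid controls the empirical CDF up to order
`√(log(pn) / n)`, and inverting `Φ` costs the reciprocal of the normal density near `B + 1`, at most
of order `n^{1/3}`; the error is of order `√(log(pn)) n^{-1/6}` (`abs_hHat_sub_le`). Outside,
Winsorization bounds the estimated scores by `3 √(log n)`, and few observations lie there. So all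
second moments are close to those of the clipped true scores, which concentrate, and whose
expectations differ from the true moments by a Gaussian tail. The total error is `√(log(pn))
n^{-1/6}` times a logarithm; `n^{ρ/2}` absorbs the powers of `log n`, which leaves a multiple of
`√(log(ps) / n^{1/3-ρ})` (`totalError_le`). The conditions on `λ` are stated in terms of this rate.
-/

/-! ### Dual certificates for the lasso -/

/-- The lasso criterion without intercept. -/
noncomputable def lassoCriterion {n p : ℕ} (x : Fin n → Fin p → ℝ) (R : Fin n → ℝ) (lam : ℝ)
    (b : Fin p → ℝ) : ℝ :=
  (n : ℝ)⁻¹ * ∑ i, (R i - ∑ j, x i j * b j) ^ 2 + ∑ j, lam * |b j|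

/-- The average of a finite sample. -/
noncomputable def sampleMean {n : ℕ} (f : Fin n → ℝ) : ℝ := (n : ℝ)⁻¹ * ∑ i, f i

/-- The loss is quadratic, so its expansion around `b'` is exact. Grouping the gradient with the
penalty coordinate by coordinate lets the certificate make each summand nonnegative separately. -/
lemma lassoCriterion_eq_add {n p : ℕ} (x : Fin n → Fin p → ℝ) (R : Fin n → ℝ) (lam : ℝ)
    (b b' : Fin p → ℝ) :
    lassoCriterion x R lam b = lassoCriterion x R lam b' +
      (n : ℝ)⁻¹ * ∑ i, (∑ j, x i j * (b j - b' j)) ^ 2 +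
      ∑ j, (lam * (|b j| - |b' j|) -
        2 * sampleMean (fun i => x i j * (R i - ∑ k, x i k * b' k)) * (b j - b' j)) := by
  have h1 : ∀ i, (R i - ∑ j, x i j * b j) ^ 2 = (R i - ∑ j, x i j * b' j) ^ 2 +
      (∑ j, x i j * (b j - b' j)) ^ 2 -
        2 * ∑ j, (x i j * (R i - ∑ k, x i k * b' k)) * (b j - b' j) := by
    intro i
    have e1 : ∑ j, x i j * (b j - b' j) = ∑ j, x i j * b j - ∑ j, x i j * b' j := by
      simp only [mul_sub, Finset.sum_sub_distrib]
    have e2 : ∑ j, (x i j * (R i - ∑ k, x i k * b' k)) * (b j - b' j) =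
        (R i - ∑ k, x i k * b' k) * ∑ j, x i j * (b j - b' j) := by
      rw [Finset.mul_sum]; exact Finset.sum_congr rfl fun j _ => by ring
    rw [e2, e1]; ring
  have h2 : ∑ j, sampleMean (fun i => x i j * (R i - ∑ k, x i k * b' k)) * (b j - b' j) =
      (n : ℝ)⁻¹ * ∑ i, ∑ j, (x i j * (R i - ∑ k, x i k * b' k)) * (b j - b' j) := by
    rw [Finset.sum_comm, Finset.mul_sum]
    refine Finset.sum_congr rfl fun j _ => ?_
    rw [sampleMean, mul_assoc, Finset.sum_mul]
  have h3 : ∑ j, (lam * (|b j| - |b' j|) -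
        2 * sampleMean (fun i => x i j * (R i - ∑ k, x i k * b' k)) * (b j - b' j)) =
      ∑ j, lam * |b j| - ∑ j, lam * |b' j| - 2 * ((n : ℝ)⁻¹ *
        ∑ i, ∑ j, (x i j * (R i - ∑ k, x i k * b' k)) * (b j - b' j)) := by
    rw [← h2, Finset.mul_sum, ← Finset.sum_sub_distrib, ← Finset.sum_sub_distrib]
    exact Finset.sum_congr rfl fun j _ => by ring
  rw [h3]
  simp only [lassoCriterion, h1, Finset.sum_sub_distrib, Finset.sum_add_distrib, mul_sub, mul_add,
    ← Finset.mul_sum]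
  ring

/-- A strict dual certificate determines every minimizer of the lasso criterion. -/
lemma lasso_eq_of_certificate {n p : ℕ} (hn : 0 < n) (x : Fin n → Fin p → ℝ) (R : Fin n → ℝ)
    {lam : ℝ} (hlam : 0 < lam) (A : Finset (Fin p)) (b b' : Fin p → ℝ)
    (hmin : lassoCriterion x R lam b ≤ lassoCriterion x R lam b')
    (hoff : ∀ j ∉ A, b' j = 0)
    (hon : ∀ j ∈ A, 2 * sampleMean (fun i => x i j * (R i - ∑ k, x i k * b' k)) =
      lam * SignType.sign (b' j))
    (hstrict : ∀ j ∉ A, |2 * sampleMean (fun i => x i j * (R i - ∑ k, x i k * b' k))| < lam)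
    (hinj : ∀ v : Fin p → ℝ, (∀ j ∉ A, v j = 0) →
      (∀ j ∈ A, ∑ k, sampleMean (fun i => x i j * x i k) * v k = 0) → ∀ j ∈ A, v j = 0) :
    b = b' := by
  have hn' : (0 : ℝ) < (n : ℝ)⁻¹ := by positivity
  set g : Fin p → ℝ := fun j => sampleMean (fun i => x i j * (R i - ∑ k, x i k * b' k)) with hg
  -- The subgradient inequality for the absolute value: on `A` the gradient is `lam` times the sign,
  -- off `A` it is smaller than `lam` in absolute value.
  have hnn : ∀ j, 0 ≤ lam * (|b j| - |b' j|) - 2 * g j * (b j - b' j) := by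
    intro j
    by_cases hj : j ∈ A
    · have h := hon j hj
      change 2 * g j = _ at h
      rw [h]
      have h1 : (SignType.sign (b' j) : ℝ) * b' j = |b' j| := sign_mul_self _
      have h2 : (SignType.sign (b' j) : ℝ) * b j ≤ |b j| := by
        rcases lt_trichotomy (b' j) 0 with h | h | h
        · simp [h, neg_le_abs]
        · simp [h]
        · simp [h, le_abs_self]
      nlinarith
    · have h := hstrict j hj
      change |2 * g j| < lam at h
      rw [hoff j hj]
      have h2 : 2 * g j * b j ≤ |2 * g j| * |b j| := by rw [← abs_mul]; exact le_abs_self _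
      have h3 := mul_le_mul_of_nonneg_right h.le (abs_nonneg (b j))
      simp only [abs_zero, sub_zero]; linarith
  have hsq : 0 ≤ (n : ℝ)⁻¹ * ∑ i, (∑ j, x i j * (b j - b' j)) ^ 2 := by positivity
  have hexp := lassoCriterion_eq_add x R lam b b'
  have hsum := Finset.sum_nonneg fun j (_ : j ∈ Finset.univ) => hnn j
  have hzero : ∑ j, (lam * (|b j| - |b' j|) - 2 * g j * (b j - b' j)) = 0 := by
    apply le_antisymm _ hsum
    change lassoCriterion x R lam b = _ + _ + ∑ j, (lam * (|b j| - |b' j|) - 2 * g j * (b j - b' j))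
      at hexp
    linarith
  have hzero2 : (n : ℝ)⁻¹ * ∑ i, (∑ j, x i j * (b j - b' j)) ^ 2 = 0 := by
    apply le_antisymm _ hsq
    change lassoCriterion x R lam b = _ + _ + ∑ j, (lam * (|b j| - |b' j|) - 2 * g j * (b j - b' j))
      at hexp
    linarith
  -- All excess terms vanish. Strictness then forces `b` to live on `A`, and the vanishing quadratic
  -- term makes `b - b'` a null vector of the active Gram block.
  have hboff : ∀ j ∉ A, b j = 0 := by
    intro j hj
    have h := (Finset.sum_eq_zero_iff_of_nonneg fun j _ => hnn j).1 hzero j (Finset.mem_univ j)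
    have hs := hstrict j hj
    change |2 * g j| < lam at hs
    rw [hoff j hj] at h
    have h2 : 2 * g j * b j ≤ |2 * g j| * |b j| := by rw [← abs_mul]; exact le_abs_self _
    by_contra hb
    have h3 := mul_lt_mul_of_pos_right hs (abs_pos.2 hb)
    simp only [abs_zero, sub_zero] at h; linarith
  have hfit : ∀ i, ∑ j, x i j * (b j - b' j) = 0 := by
    have := (mul_eq_zero.1 hzero2).resolve_left hn'.ne'
    intro i
    have h := (Finset.sum_eq_zero_iff_of_nonneg fun i _ => sq_nonneg _).1 this i (Finset.mem_univ i)
    exact pow_eq_zero_iff two_ne_zero |>.1 h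
  have hv := hinj (fun j => b j - b' j) (fun j hj => by simp [hboff j hj, hoff j hj]) (by
    intro j _
    have : ∑ k, sampleMean (fun i => x i j * x i k) * (b k - b' k) =
        (n : ℝ)⁻¹ * ∑ i, x i j * ∑ k, x i k * (b k - b' k) := by
      simp only [sampleMean, Finset.mul_sum, Finset.sum_mul]
      rw [Finset.sum_comm]
      exact Finset.sum_congr rfl fun i _ => Finset.sum_congr rfl fun k _ => by ring
    rw [this]; simp [hfit])
  funext j
  by_cases hj : j ∈ A
  · exact sub_eq_zero.1 (hv j hj)
  · rw [hboff j hj, hoff j hj]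

lemma sum_mul_dite_mem {p : ℕ} (A : Finset (Fin p)) (f : Fin p → ℝ) (w : {j // j ∈ A} → ℝ) :
    ∑ k, f k * (if h : k ∈ A then w ⟨k, h⟩ else 0) = ∑ k : {j // j ∈ A}, f k * w k := by
  have h1 : ∑ k : {j // j ∈ A}, f k * w k =
      ∑ k ∈ A.attach, f k * (if h : (k : Fin p) ∈ A then w ⟨k, h⟩ else 0) := by
    rw [Finset.univ_eq_attach]
    exact Finset.sum_congr rfl fun k _ => by simp [k.2]
  rw [h1, Finset.sum_attach A fun k => f k * (if h : k ∈ A then w ⟨k, h⟩ else 0)]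
  symm
  apply Finset.sum_subset (Finset.subset_univ _)
  intro k _ hk; simp [hk]

lemma abs_sum_mul_le {p : ℕ} (A : Finset (Fin p)) (f v : Fin p → ℝ) {ε t : ℝ} (hε : 0 ≤ ε)
    (hf : ∀ k ∈ A, |f k| ≤ ε) (hv0 : ∀ k ∉ A, v k = 0) (hv : ∀ k ∈ A, |v k| ≤ t) :
    |∑ k, f k * v k| ≤ A.card * ε * t := by
  have : ∑ k, f k * v k = ∑ k ∈ A, f k * v k := by
    symm; apply Finset.sum_subset (Finset.subset_univ _)
    intro k _ hk; simp [hv0 k hk]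
  rw [this]
  calc _ ≤ ∑ k ∈ A, |f k * v k| := Finset.abs_sum_le_sum_abs _ _
    _ ≤ ∑ k ∈ A, ε * t := Finset.sum_le_sum fun k hk => by
        rw [abs_mul]; exact mul_le_mul (hf k hk) (hv k hk) (abs_nonneg _) hε
    _ = _ := by rw [Finset.sum_const, nsmul_eq_mul]; ring

/-- Invertibility of the active block is stable under small entrywise perturbations. -/
lemma abs_le_of_perturbed_block {p : ℕ} {A : Finset (Fin p)} (hA : A.Nonempty)
    {Om G : Matrix (Fin p) (Fin p) ℝ} {ph ε : ℝ} (hε : 0 ≤ ε)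
    (hinv : ∀ (v : Fin p → ℝ) (t : ℝ), (∀ k ∉ A, v k = 0) →
      (∀ j ∈ A, |∑ k, Om j k * v k| ≤ t) → ∀ j ∈ A, |v j| ≤ ph * t)
    (hG : ∀ j, ∀ k ∈ A, |G j k - Om j k| ≤ ε) (hsmall : ph * (A.card * ε) ≤ 1 / 2)
    {v : Fin p → ℝ} {t : ℝ} (hv0 : ∀ k ∉ A, v k = 0)
    (hv : ∀ j ∈ A, |∑ k, G j k * v k| ≤ t) : ∀ j ∈ A, |v j| ≤ 2 * ph * t := by
  -- Bound the largest coordinate by itself: the perturbation contributes at most half of it, which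
  -- is absorbed on the left and doubles the constant.
  obtain ⟨j0, hj0, hmax⟩ := A.exists_max_image (fun j => |v j|) hA
  have h1 : ∀ j ∈ A, |∑ k, Om j k * v k| ≤ t + A.card * ε * |v j0| := by
    intro j hj
    have e : ∑ k, Om j k * v k = ∑ k, G j k * v k - ∑ k, (G j k - Om j k) * v k := by
      rw [← Finset.sum_sub_distrib]; exact Finset.sum_congr rfl fun k _ => by ring
    rw [e]
    refine (abs_sub _ _).trans (add_le_add (hv j hj) ?_)
    exact abs_sum_mul_le A _ _ hε (hG j) hv0 hmax
  have h2 := hinv v _ hv0 h1 j0 hj0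
  have h3 : ph * (A.card * ε) * |v j0| ≤ 1 / 2 * |v j0| :=
    mul_le_mul_of_nonneg_right hsmall (abs_nonneg _)
  intro j hj
  have := hmax j hj
  linarith [mul_add ph t (A.card * ε * |v j0|), mul_assoc ph (A.card * ε) |v j0|]

/-- Existence of a lasso certificate near the population coefficients. -/
lemma exists_lasso_certificate {p : ℕ} {A : Finset (Fin p)} (hA : A.Nonempty)
    {Om G : Matrix (Fin p) (Fin p) ℝ} {ph ka ε lam m : ℝ} {β d dh : Fin p → ℝ}
    (hph : 0 ≤ ph) (hε : 0 ≤ ε) (hlam : 0 < lam)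
    (hinv : ∀ (v : Fin p → ℝ) (t : ℝ), (∀ k ∉ A, v k = 0) →
      (∀ j ∈ A, |∑ k, Om j k * v k| ≤ t) → ∀ j ∈ A, |v j| ≤ ph * t)
    (hirr : ∀ (v : Fin p → ℝ) (t : ℝ), (∀ k ∉ A, v k = 0) →
      (∀ j ∈ A, |∑ k, Om j k * v k| ≤ t) → ∀ j ∉ A, |∑ k, Om j k * v k| ≤ ka * t)
    (hG : ∀ j, ∀ k ∈ A, |G j k - Om j k| ≤ ε)
    (hd : ∀ j, |dh j - d j| ≤ ε)
    (hβ0 : ∀ j ∉ A, β j = 0) (hβd : ∀ j, ∑ k, Om j k * β k = d j)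
    (hβm : ∀ j ∈ A, |β j| ≤ m)
    (hsmall : ph * (A.card * ε) ≤ 1 / 2) (hη : ε + A.card * ε * m ≤ lam / 4)
    (hβmin : ∀ j ∈ A, 2 * ph * lam < |β j|)
    (hκ : ka * (lam / 2 + (ε + A.card * ε * m) + A.card * ε * (2 * ph * lam)) +
      A.card * ε * (2 * ph * lam) + (ε + A.card * ε * m) < lam / 2) :
    ∃ b : Fin p → ℝ, (∀ j ∉ A, b j = 0) ∧ (∀ j ∈ A, b j ≠ 0) ∧
      (∀ j ∈ A, 2 * (dh j - ∑ k, G j k * b k) = lam * SignType.sign (b j)) ∧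
      (∀ j ∉ A, |2 * (dh j - ∑ k, G j k * b k)| < lam) ∧
      (∀ j ∈ A, |b j - β j| ≤ 4 * ph * lam) := by
  set η := ε + A.card * ε * m with hηdef
  have hpert := fun {v : Fin p → ℝ} {t : ℝ} =>
    abs_le_of_perturbed_block (v := v) (t := t) hA hε hinv hG hsmall
  set T : ({j // j ∈ A} → ℝ) →ₗ[ℝ] ({j // j ∈ A} → ℝ) :=
    Matrix.mulVecLin (G.submatrix Subtype.val Subtype.val) with hT
  have hTapp : ∀ w (j : {j // j ∈ A}), T w j =
      ∑ k, G j k * (if h : k ∈ A then w ⟨k, h⟩ else 0) := by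
    intro w j
    rw [sum_mul_dite_mem]; rfl
  have hTinj : Function.Injective T := by
    rw [← LinearMap.ker_eq_bot, LinearMap.ker_eq_bot']
    intro w hw
    funext j
    have h := hpert (v := fun k => if h : k ∈ A then w ⟨k, h⟩ else 0) (t := 0)
      (fun k hk => by simp [hk]) (fun j hj => by rw [← hTapp w ⟨j, hj⟩, hw]; simp) j j.2
    simpa [j.2] using h
  -- The displacement from `β` that solves the stationarity equations on `A`, with the sign of the
  -- unknown solution replaced by that of `β`.
  obtain ⟨w, hw⟩ := LinearMap.injective_iff_surjective.1 hTinj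
    (fun j => dh j - ∑ k, G j k * β k - lam / 2 * SignType.sign (β j))
  set u : Fin p → ℝ := fun k => if h : k ∈ A then w ⟨k, h⟩ else 0 with hu
  have hu0 : ∀ k ∉ A, u k = 0 := fun k hk => by simp [hu, hk]
  have hGu : ∀ j ∈ A, ∑ k, G j k * u k =
      dh j - ∑ k, G j k * β k - lam / 2 * SignType.sign (β j) := by
    intro j hj
    rw [← hTapp w ⟨j, hj⟩, hw]
  have hr : ∀ j, |dh j - ∑ k, G j k * β k| ≤ η := by
    intro j
    have e : dh j - ∑ k, G j k * β k = (dh j - d j) - ∑ k, (G j k - Om j k) * β k := by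
      rw [← hβd j]
      simp only [sub_mul, Finset.sum_sub_distrib]; ring
    rw [e]
    exact (abs_sub _ _).trans (add_le_add (hd j) (abs_sum_mul_le A _ _ hε (hG j) hβ0 hβm))
  have hsign : ∀ y : ℝ, |(SignType.sign y : ℝ)| ≤ 1 := by
    intro y; rcases lt_trichotomy y 0 with h | h | h <;> simp [h]
  have hGu' : ∀ j ∈ A, |∑ k, G j k * u k| ≤ lam / 2 + η := by
    intro j hj
    rw [hGu j hj]
    refine (abs_sub _ _).trans ?_
    rw [abs_mul, abs_of_pos (by positivity : 0 < lam / 2)]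
    have := hsign (β j)
    nlinarith [hr j]
  have hub : ∀ j ∈ A, |u j| ≤ 2 * ph * lam := by
    intro j hj
    refine (hpert hu0 hGu' j hj).trans ?_
    apply mul_le_mul_of_nonneg_left _ (by positivity); linarith
  -- The displacement is smaller than `|β j|`, which justifies the frozen signs.
  have hsgn : ∀ j ∈ A, SignType.sign (β j + u j) = SignType.sign (β j) := by
    intro j hj
    have h1 := hβmin j hj
    have h2 := abs_le.1 (hub j hj)
    rcases lt_trichotomy (β j) 0 with h | h | h
    · rw [abs_of_neg h] at h1
      rw [sign_neg h, sign_neg (by linarith)]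
    · have : 0 ≤ 2 * ph * lam := by positivity
      rw [h, abs_zero] at h1; linarith
    · rw [abs_of_pos h] at h1
      rw [sign_pos h, sign_pos (by linarith)]
  have hlin : ∀ j, ∑ k, G j k * (β k + u k) = ∑ k, G j k * β k + ∑ k, G j k * u k := by
    intro j; simp only [mul_add, Finset.sum_add_distrib]
  refine ⟨fun j => β j + u j, fun j hj => by simp [hβ0 j hj, hu0 j hj], fun j hj h => ?_,
    fun j hj => ?_, fun j hj => ?_, fun j hj => ?_⟩
  · have h1 := hβmin j hj
    have h2 := hub j hj
    have h3 : u j = -β j := by linarith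
    rw [h3, abs_neg] at h2; linarith
  · change _ = lam * (SignType.sign (β j + u j) : ℝ)
    rw [hsgn j hj, hlin, hGu j hj]; ring
  -- Off `A` half the gradient is the residual at `β` minus `G u`. Up to perturbation `G u` is `Om
  -- u`, at most `ka` times its size on `A`, which is about `lam / 2`.
  · rw [hlin]
    have h0 : ∀ j, |∑ k, (G j k - Om j k) * u k| ≤ A.card * ε * (2 * ph * lam) := fun j =>
      abs_sum_mul_le A _ _ hε (hG j) hu0 hub
    have e : ∀ j, ∑ k, Om j k * u k = ∑ k, G j k * u k - ∑ k, (G j k - Om j k) * u k := by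
      intro j
      rw [← Finset.sum_sub_distrib]; exact Finset.sum_congr rfl fun k _ => by ring
    have h1 : ∀ j ∈ A, |∑ k, Om j k * u k| ≤ lam / 2 + η + A.card * ε * (2 * ph * lam) := by
      intro j hj
      rw [e]
      exact (abs_sub _ _).trans (add_le_add (hGu' j hj) (h0 j))
    have h2 := hirr u _ hu0 h1 j hj
    have h3 := h0 j
    have h4 := hr j
    have e' := e j
    rw [abs_le] at h2 h3 h4
    rw [abs_lt]
    constructor <;> linarith [h2.1, h2.2, h3.1, h3.2, h4.1, h4.2]
  · simp only [add_sub_cancel_left]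
    refine (hub j hj).trans ?_
    have : 0 ≤ ph * lam := by positivity
    linarith

/-! ### Sample moments and elimination of the intercept -/

lemma sampleMean_add {n : ℕ} (f g : Fin n → ℝ) :
    sampleMean (fun i => f i + g i) = sampleMean f + sampleMean g := by
  simp only [sampleMean, Finset.sum_add_distrib, mul_add]

lemma sampleMean_sub {n : ℕ} (f g : Fin n → ℝ) :
    sampleMean (fun i => f i - g i) = sampleMean f - sampleMean g := by
  simp only [sampleMean, Finset.sum_sub_distrib, mul_sub]

lemma sampleMean_mul_const {n : ℕ} (f : Fin n → ℝ) (a : ℝ) :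
    sampleMean (fun i => f i * a) = sampleMean f * a := by
  simp only [sampleMean, Finset.sum_mul, Finset.mul_sum, mul_assoc]

lemma sampleMean_const_mul {n : ℕ} (f : Fin n → ℝ) (a : ℝ) :
    sampleMean (fun i => a * f i) = a * sampleMean f := by
  simp only [mul_comm a, sampleMean_mul_const]

lemma sampleMean_const {n : ℕ} (hn : 0 < n) (a : ℝ) :
    sampleMean (fun _ : Fin n => a) = a := by
  have : (n : ℝ) ≠ 0 := by positivity
  simp [sampleMean, this]

lemma sampleMean_sum {n : ℕ} {ι : Type*} (s : Finset ι) (f : ι → Fin n → ℝ) :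
    sampleMean (fun i => ∑ k ∈ s, f k i) = ∑ k ∈ s, sampleMean (f k) := by
  simp only [sampleMean, Finset.mul_sum]; rw [Finset.sum_comm]

lemma sampleMean_mono {n : ℕ} {f g : Fin n → ℝ} (h : ∀ i, f i ≤ g i) :
    sampleMean f ≤ sampleMean g :=
  mul_le_mul_of_nonneg_left (Finset.sum_le_sum fun i _ => h i) (by positivity)

lemma abs_sampleMean_le {n : ℕ} (f : Fin n → ℝ) :
    |sampleMean f| ≤ sampleMean fun i => |f i| := by
  rw [sampleMean, abs_mul, abs_of_nonneg (by positivity : (0 : ℝ) ≤ (n : ℝ)⁻¹)]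
  exact mul_le_mul_of_nonneg_left (Finset.abs_sum_le_sum_abs _ _) (by positivity)

/-- The sample covariance. -/
noncomputable def sampleCov {n : ℕ} (f g : Fin n → ℝ) : ℝ :=
  sampleMean (fun i => f i * g i) - sampleMean f * sampleMean g

lemma sampleMean_centered_mul {n : ℕ} (hn : 0 < n) (f g : Fin n → ℝ) :
    sampleMean (fun i => (f i - sampleMean f) * (g i - sampleMean g)) = sampleCov f g := by
  have : ∀ i, (f i - sampleMean f) * (g i - sampleMean g) =
      f i * g i - f i * sampleMean g - sampleMean f * g i + sampleMean f * sampleMean g := by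
    intro i; ring
  simp only [this]
  rw [sampleMean_add, sampleMean_sub, sampleMean_sub, sampleMean_mul_const, sampleMean_const_mul,
    sampleMean_const hn, sampleCov]
  ring

lemma sum_sub_sq_eq {n : ℕ} (hn : 0 < n) (e : Fin n → ℝ) (a : ℝ) :
    ∑ i, (e i - a) ^ 2 = ∑ i, (e i - sampleMean e) ^ 2 + n * (sampleMean e - a) ^ 2 := by
  have hn' : (n : ℝ) ≠ 0 := by positivity
  have hs : ∑ i, e i = n * sampleMean e := by rw [sampleMean]; field_simp
  have h1 : ∀ a : ℝ, ∑ i, (e i - a) ^ 2 = ∑ i, e i ^ 2 - 2 * a * ∑ i, e i + n * a ^ 2 := by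
    intro a
    have : ∀ i, (e i - a) ^ 2 = e i ^ 2 - 2 * a * e i + a ^ 2 := fun i => by ring
    simp only [this, Finset.sum_add_distrib, Finset.sum_sub_distrib, ← Finset.mul_sum]
    simp
  rw [h1, h1, hs]; ring

/-- For fixed `b` the best intercept is the mean residual, and any other one only adds a square.
Profiling it out centers the scores and the response, whose Gram entries are then sample
covariances. -/
lemma IsSSDA.lassoCriterion_le {n p : ℕ} (hn : 0 < n) {X : Fin n → Fin p → ℝ} {Y R : Fin n → ℝ}
    {lam b0 : ℝ} {b : Fin p → ℝ} (h : IsSSDA X Y R lam b0 b) (c : Fin p → ℝ) :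
    lassoCriterion
      (fun i j => hHat X Y j (X i j) - sampleMean fun i => hHat X Y j (X i j))
      (fun i => R i - sampleMean R) lam b ≤
    lassoCriterion
      (fun i j => hHat X Y j (X i j) - sampleMean fun i => hHat X Y j (X i j))
      (fun i => R i - sampleMean R) lam c := by
  set x : Fin n → Fin p → ℝ := fun i j => hHat X Y j (X i j) with hx
  have hres : ∀ (a : Fin p → ℝ) i,
      R i - sampleMean R - ∑ j, (x i j - sampleMean fun i => x i j) * a j =
        (R i - ∑ j, x i j * a j) - sampleMean fun i => R i - ∑ j, x i j * a j := by
    intro a i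
    rw [sampleMean_sub, sampleMean_sum]
    simp only [sampleMean_mul_const, sub_mul, Finset.sum_sub_distrib]
    ring
  have hcrit : ∀ (a0 : ℝ) (a : Fin p → ℝ), ssdaCriterion X Y R lam a0 a =
      lassoCriterion (fun i j => x i j - sampleMean fun i => x i j)
        (fun i => R i - sampleMean R) lam a +
      (n : ℝ)⁻¹ * (n * ((sampleMean fun i => R i - ∑ j, x i j * a j) - a0) ^ 2) := by
    intro a0 a
    have e : ∀ i, R i - a0 - ∑ j, hHat X Y j (X i j) * a j = (R i - ∑ j, x i j * a j) - a0 :=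
      fun i => by rw [hx]; ring
    simp only [ssdaCriterion, lassoCriterion, hres, e]
    rw [sum_sub_sq_eq hn (fun i => R i - ∑ j, x i j * a j) a0]
    ring
  have h1 := h (sampleMean fun i => R i - ∑ j, x i j * c j) c
  rw [hcrit, hcrit] at h1
  have h2 : 0 ≤ (n : ℝ)⁻¹ * (n * ((sampleMean fun i => R i - ∑ j, x i j * b j) - b0) ^ 2) := by
    positivity
  simp only [sub_self] at h1
  linarith

/-- Support recovery and sup norm error of the SSDA estimator, given entrywise bounds on the
estimated covariances. -/
lemma IsSSDA.selected_eq {n p : ℕ} (hn : 0 < n) {X : Fin n → Fin p → ℝ} {Y R : Fin n → ℝ}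
    {lam b0 : ℝ} {b : Fin p → ℝ} (h : IsSSDA X Y R lam b0 b)
    {A : Finset (Fin p)} (hA : A.Nonempty)
    {Om : Matrix (Fin p) (Fin p) ℝ} {ph ka ε m : ℝ} {β d : Fin p → ℝ}
    (hph : 0 ≤ ph) (hε : 0 ≤ ε) (hlam : 0 < lam)
    (hinv : ∀ (v : Fin p → ℝ) (t : ℝ), (∀ k ∉ A, v k = 0) →
      (∀ j ∈ A, |∑ k, Om j k * v k| ≤ t) → ∀ j ∈ A, |v j| ≤ ph * t)
    (hirr : ∀ (v : Fin p → ℝ) (t : ℝ), (∀ k ∉ A, v k = 0) →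
      (∀ j ∈ A, |∑ k, Om j k * v k| ≤ t) → ∀ j ∉ A, |∑ k, Om j k * v k| ≤ ka * t)
    (hG : ∀ j k, |sampleCov (fun i => hHat X Y j (X i j)) (fun i => hHat X Y k (X i k)) - Om j k|
      ≤ ε)
    (hd : ∀ j, |sampleCov (fun i => hHat X Y j (X i j)) R - d j| ≤ ε)
    (hβ0 : ∀ j ∉ A, β j = 0) (hβd : ∀ j, ∑ k, Om j k * β k = d j)
    (hβm : ∀ j ∈ A, |β j| ≤ m)
    (hsmall : ph * (A.card * ε) ≤ 1 / 2) (hη : ε + A.card * ε * m ≤ lam / 4)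
    (hβmin : ∀ j ∈ A, 2 * ph * lam < |β j|)
    (hκ : ka * (lam / 2 + (ε + A.card * ε * m) + A.card * ε * (2 * ph * lam)) +
      A.card * ε * (2 * ph * lam) + (ε + A.card * ε * m) < lam / 2) :
    selected b = A ∧ ∀ j ∈ A, |b j - β j| ≤ 4 * ph * lam := by
  set G : Matrix (Fin p) (Fin p) ℝ := Matrix.of fun j k =>
    sampleCov (fun i => hHat X Y j (X i j)) (fun i => hHat X Y k (X i k)) with hGdef
  have hG' : ∀ j, ∀ k ∈ A, |G j k - Om j k| ≤ ε := fun j k _ => hG j k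
  obtain ⟨b', h0, hne, hon, hstrict, herr⟩ := exists_lasso_certificate hA hph hε hlam hinv hirr hG'
    hd hβ0 hβd hβm hsmall hη hβmin hκ
  set xc : Fin n → Fin p → ℝ :=
    fun i j => hHat X Y j (X i j) - sampleMean fun i => hHat X Y j (X i j) with hxc
  set Rc : Fin n → ℝ := fun i => R i - sampleMean R with hRc
  have hGx : ∀ j k, sampleMean (fun i => xc i j * xc i k) = G j k := fun j k =>
    sampleMean_centered_mul hn (fun i => hHat X Y j (X i j)) (fun i => hHat X Y k (X i k))
  have hgrad : ∀ j, sampleMean (fun i => xc i j * (Rc i - ∑ k, xc i k * b' k)) =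
      sampleCov (fun i => hHat X Y j (X i j)) R - ∑ k, G j k * b' k := by
    intro j
    have e : ∀ i, xc i j * (Rc i - ∑ k, xc i k * b' k) =
        xc i j * Rc i - ∑ k, xc i j * xc i k * b' k := by
      intro i; rw [mul_sub, Finset.mul_sum]; simp only [mul_assoc]
    simp only [e]
    rw [sampleMean_sub, sampleMean_sum]
    simp only [sampleMean_mul_const, hGx]
    rw [← sampleMean_centered_mul hn]
  have hb : b = b' := by
    refine lasso_eq_of_certificate hn xc Rc hlam A b b' (h.lassoCriterion_le hn b') h0
      (fun j hj => by rw [hgrad]; exact hon j hj) (fun j hj => by rw [hgrad]; exact hstrict j hj) ?_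
    intro v hv0 hv j hj
    have := abs_le_of_perturbed_block hA hε hinv hG' hsmall hv0 (t := 0) (fun j hj => by
      have := hv j hj
      simp only [hGx] at this
      rw [this, abs_zero]) j hj
    rw [mul_zero] at this
    exact abs_eq_zero.1 (le_antisymm this (abs_nonneg _))
  subst hb
  refine ⟨?_, herr⟩
  ext j
  simp only [selected, Finset.mem_filter, Finset.mem_univ, true_and]
  exact ⟨fun hj => by by_contra hA'; exact hj (h0 j hA'), hne j⟩

/-! ### Hoeffding bounds -/

lemma measureReal_abs_sampleMean_sub_ge {E S : Type*} [MeasurableSpace E] [MeasurableSpace S]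
    {P : Measure S} [IsProbabilityMeasure P] {law : Measure E} {n : ℕ} (hn : 0 < n)
    {W : Fin n → S → E} (hW : ∀ i, HasLaw (W i) law P) (hind : iIndepFun W P)
    {g : E → ℝ} (hg : Measurable g) (hg1 : ∀ z, |g z| ≤ 1) {ε : ℝ} (hε : 0 ≤ ε) :
    P.real {ω | ε ≤ |sampleMean (fun i => g (W i ω)) - ∫ z, g z ∂law|} ≤
      2 * Real.exp (-(n * ε ^ 2) / 2) := by
  have hn' : (0 : ℝ) < n := by positivity
  have key : ∀ f : E → ℝ, Measurable f → (∀ z, |f z| ≤ 1) →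
      P.real {ω | n * ε ≤ ∑ i, (f (W i ω) - ∫ z, f z ∂law)} ≤ Real.exp (-(n * ε ^ 2) / 2) := by
    intro f hf hf1
    -- Hoeffding's lemma on `[-1, 1]`: the variance proxy is the squared half-length, `1`.
    have hsub : ∀ i ∈ (Finset.univ : Finset (Fin n)),
        HasSubgaussianMGF (fun ω => f (W i ω) - ∫ z, f z ∂law) 1 P := by
      intro i _
      have h := hasSubgaussianMGF_of_mem_Icc (μ := P) (X := fun ω => f (W i ω)) (a := -1) (b := 1)
        (hf.comp_aemeasurable (hW i).aemeasurable)
        (Filter.Eventually.of_forall fun ω => abs_le.1 (hf1 _))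
      have e : P[fun ω => f (W i ω)] = ∫ z, f z ∂law :=
        (hW i).integral_comp hf.aestronglyMeasurable
      rw [e] at h
      convert h using 1
      ext; norm_num
    have hind' : iIndepFun (fun i ω => f (W i ω) - ∫ z, f z ∂law) P :=
      hind.comp (fun _ z => f z - ∫ z, f z ∂law) fun _ => hf.sub_const _
    have h := HasSubgaussianMGF.measure_sum_ge_le_of_iIndepFun hind' hsub (ε := n * ε)
      (by positivity)
    refine h.trans (le_of_eq ?_)
    congr 1
    simp
    field_simp
  have h1 := key g hg hg1
  have h2 := key (fun z => -g z) hg.neg fun z => by rw [abs_neg]; exact hg1 z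
  have hsubset : {ω | ε ≤ |sampleMean (fun i => g (W i ω)) - ∫ z, g z ∂law|} ⊆
      {ω | n * ε ≤ ∑ i, (g (W i ω) - ∫ z, g z ∂law)} ∪
      {ω | n * ε ≤ ∑ i, (-g (W i ω) - ∫ z, -g z ∂law)} := by
    intro ω hω
    have e1 : ∑ i, (g (W i ω) - ∫ z, g z ∂law) =
        n * (sampleMean (fun i => g (W i ω)) - ∫ z, g z ∂law) := by
      rw [Finset.sum_sub_distrib, sampleMean]
      simp; field_simp
    have e2 : ∑ i, (-g (W i ω) - ∫ z, -g z ∂law) =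
        n * -(sampleMean (fun i => g (W i ω)) - ∫ z, g z ∂law) := by
      rw [integral_neg, mul_neg, ← e1, ← Finset.sum_neg_distrib]
      exact Finset.sum_congr rfl fun i _ => by ring
    rcases le_abs'.1 (show ε ≤ |_| from hω) with h | h
    · right
      rw [Set.mem_ofPred_eq, e2]
      exact mul_le_mul_of_nonneg_left (by linarith) hn'.le
    · left
      rw [Set.mem_ofPred_eq, e1]
      exact mul_le_mul_of_nonneg_left h hn'.le
  calc _ ≤ _ := measureReal_mono hsubset
    _ ≤ _ := measureReal_union_le _ _
    _ ≤ _ := by linarith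

/-- A uniform Hoeffding bound over a finite family of functions. -/
lemma measureReal_exists_abs_sampleMean_sub_ge {E S ι : Type*} [MeasurableSpace E]
    [MeasurableSpace S] {P : Measure S} [IsProbabilityMeasure P] {law : Measure E} {n : ℕ}
    (hn : 0 < n) {W : Fin n → S → E} (hW : ∀ i, HasLaw (W i) law P) (hind : iIndepFun W P)
    [Fintype ι] {g : ι → E → ℝ} {b : ι → ℝ} (hb : ∀ a, 0 < b a) (hg : ∀ a, Measurable (g a))
    (hgb : ∀ a z, |g a z| ≤ b a) {ε : ℝ} (hε : 0 ≤ ε) :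
    P.real {ω | ∃ a, b a * ε ≤ |sampleMean (fun i => g a (W i ω)) - ∫ z, g a z ∂law|} ≤
      Fintype.card ι * (2 * Real.exp (-(n * ε ^ 2) / 2)) := by
  have e : {ω | ∃ a, b a * ε ≤ |sampleMean (fun i => g a (W i ω)) - ∫ z, g a z ∂law|} =
      ⋃ a, {ω | ε ≤ |sampleMean (fun i => g a (W i ω) * (b a)⁻¹) -
        ∫ z, g a z * (b a)⁻¹ ∂law|} := by
    ext ω
    simp only [Set.mem_iUnion, Set.mem_ofPred_eq]
    refine exists_congr fun a => ?_
    rw [sampleMean_mul_const, integral_mul_const, ← sub_mul, abs_mul,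
      abs_of_pos (inv_pos.2 (hb a)), ← div_eq_mul_inv, le_div_iff₀ (hb a), mul_comm]
  rw [e]
  refine (measureReal_iUnion_fintype_le _).trans ?_
  refine (Finset.sum_le_sum fun a _ =>
    measureReal_abs_sampleMean_sub_ge hn hW hind ((hg a).mul_const _) (fun z => ?_) hε).trans ?_
  · rw [abs_mul, abs_of_pos (inv_pos.2 (hb a)), ← div_eq_mul_inv]
    exact div_le_one_of_le₀ (hgb a z) (hb a).le
  · simp

/-! ### Gaussian density, tails and quantiles -/

/-- On `[-r, r]` the normal density is at least its value at `r`, and `√(2π) ≤ 3`. This lower bound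
is what turns errors of a CDF into errors of its quantiles. -/
lemma cdf_gaussianReal_sub_ge {a b r : ℝ} (hab : a ≤ b) (ha : -r ≤ a) (hb : b ≤ r) :
    (b - a) * (Real.exp (-r ^ 2 / 2) / 3) ≤
      cdf (gaussianReal 0 1) b - cdf (gaussianReal 0 1) a := by
  have h1 : cdf (gaussianReal 0 1) b - cdf (gaussianReal 0 1) a =
      ∫ x in Set.Ioc a b, gaussianPDFReal 0 1 x := by
    rw [cdf_eq_real, cdf_eq_real, ← measureReal_sdiff (Set.Iic_subset_Iic.2 hab) measurableSet_Iic,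
      Set.Iic_sdiff_Iic, measureReal_def, gaussianReal_apply_eq_integral _ one_ne_zero,
      ENNReal.toReal_ofReal]
    exact setIntegral_nonneg measurableSet_Ioc fun x _ => gaussianPDFReal_nonneg _ _ _
  have h3 : (1 : ℝ) / 3 ≤ (√(2 * Real.pi * ((1 : NNReal) : ℝ)))⁻¹ := by
    rw [one_div]
    apply inv_anti₀ (by have := Real.pi_pos; positivity)
    rw [Real.sqrt_le_left (by norm_num)]
    have := Real.pi_lt_four
    norm_num; linarith
  have h2 : ∫ x in Set.Ioc a b, Real.exp (-r ^ 2 / 2) / 3 ≤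
      ∫ x in Set.Ioc a b, gaussianPDFReal 0 1 x := by
    apply setIntegral_mono_on (by simp) (integrable_gaussianPDFReal 0 1).integrableOn
      measurableSet_Ioc
    intro x hx
    have hr : x ^ 2 ≤ r ^ 2 := sq_le_sq' (by linarith [hx.1]) (by linarith [hx.2])
    rw [gaussianPDFReal, div_eq_mul_one_div, mul_comm]
    apply mul_le_mul h3 _ (by positivity) (by positivity)
    apply Real.exp_le_exp.2
    simp; linarith
  rw [h1]
  refine le_trans (le_of_eq ?_) h2
  rw [setIntegral_const]
  simp [hab]

lemma cdf_gaussianReal_neg_le {r : ℝ} (hr : 0 ≤ r) :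
    cdf (gaussianReal 0 1) (-r) ≤ Real.exp (-r ^ 2 / 2) := by
  have h := measure_le_le_exp_mul_mgf (μ := gaussianReal 0 1) (X := id) (-r) (t := -r) (by linarith)
    (integrable_exp_mul_gaussianReal (-r))
  rw [mgf_id_gaussianReal] at h
  rw [cdf_eq_real]
  refine h.trans (le_of_eq ?_)
  rw [← Real.exp_add]; congr 1; simp; ring

lemma one_sub_cdf_gaussianReal_le {r : ℝ} (hr : 0 ≤ r) :
    1 - cdf (gaussianReal 0 1) r ≤ Real.exp (-r ^ 2 / 2) := by
  have h := measure_ge_le_exp_mul_mgf (μ := gaussianReal 0 1) (X := id) r (t := r) hr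
    (integrable_exp_mul_gaussianReal r)
  rw [mgf_id_gaussianReal] at h
  rw [cdf_eq_real, ← probReal_compl_eq_one_sub measurableSet_Iic]
  refine (measureReal_mono (fun x hx => ?_)).trans (h.trans (le_of_eq ?_))
  · simp only [Set.mem_compl_iff, Set.mem_Iic, not_le] at hx
    exact hx.le
  · rw [← Real.exp_add]; congr 1; simp; ring

/-- On `B < |z|` use `z² ≤ 2 e^{|z|}` and `B² ≤ B |z|`. The exponent `B + 1` is near the optimal
Chernoff tilt, so the Gaussian moment generating function recovers the decay `e^{-B²/2}` up to a
factor exponential in `B`. -/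
lemma sq_indicator_le_exp {B : ℝ} (hB : 0 ≤ B) (z : ℝ) :
    (if B < |z| then z ^ 2 else 0) ≤
      2 * Real.exp (-B ^ 2) * (Real.exp ((B + 1) * z) + Real.exp (-(B + 1) * z)) := by
  split_ifs with h
  · have h1 := Real.quadratic_le_exp_of_nonneg (abs_nonneg z)
    have h2 : z ^ 2 ≤ 2 * Real.exp |z| := by
      rw [← sq_abs]; linarith [abs_nonneg z]
    have h3 : Real.exp |z| ≤ Real.exp (-B ^ 2) * Real.exp ((B + 1) * |z|) := by
      rw [← Real.exp_add]; apply Real.exp_le_exp.2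
      nlinarith
    have h4 : Real.exp ((B + 1) * |z|) ≤ Real.exp ((B + 1) * z) + Real.exp (-(B + 1) * z) := by
      rcases abs_cases z with ⟨e, _⟩ | ⟨e, _⟩ <;> rw [e]
      · linarith [Real.exp_pos (-(B + 1) * z)]
      · have : (B + 1) * -z = -(B + 1) * z := by ring
        rw [this]; linarith [Real.exp_pos ((B + 1) * z)]
    have h5 := mul_le_mul_of_nonneg_left h4 (Real.exp_pos (-B ^ 2)).le
    linarith
  · positivity

/-- The truncated second moment of a normal distribution with bounded mean. -/
lemma integral_sq_indicator_gaussianReal_le {B C μ : ℝ} (hB : 0 ≤ B) (hμ : |μ| ≤ C) :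
    ∫ z, (if B < |z| then z ^ 2 else 0) ∂(gaussianReal μ 1) ≤
      4 * Real.exp (-B ^ 2 / 2 + (C + 1) * B + C + 1 / 2) := by
  have hi : ∀ t : ℝ, Integrable (fun z => Real.exp (t * z)) (gaussianReal μ 1) := fun t =>
    integrable_exp_mul_gaussianReal t
  have hm : ∀ t : ℝ, ∫ z, Real.exp (t * z) ∂(gaussianReal μ 1) = Real.exp (μ * t + t ^ 2 / 2) := by
    intro t
    have := congrFun (mgf_id_gaussianReal (μ := μ) (v := 1)) t
    simpa [mgf] using this
  have h1 : ∫ z, (if B < |z| then z ^ 2 else 0) ∂(gaussianReal μ 1) ≤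
      ∫ z, 2 * Real.exp (-B ^ 2) * (Real.exp ((B + 1) * z) + Real.exp (-(B + 1) * z))
        ∂(gaussianReal μ 1) := by
    apply integral_mono_of_nonneg
    · exact Filter.Eventually.of_forall fun z => by
        simp only [Pi.zero_apply]; split_ifs <;> positivity
    · exact ((hi _).add (hi _)).const_mul _
    · exact Filter.Eventually.of_forall fun z => sq_indicator_le_exp hB z
  refine h1.trans ?_
  rw [integral_const_mul, integral_add (hi _) (hi _), hm, hm]
  have hb : ∀ t : ℝ, |t| = B + 1 → Real.exp (-B ^ 2) * Real.exp (μ * t + t ^ 2 / 2) ≤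
      Real.exp (-B ^ 2 / 2 + (C + 1) * B + C + 1 / 2) := by
    intro t ht
    rw [← Real.exp_add]; apply Real.exp_le_exp.2
    have h2 : μ * t ≤ C * (B + 1) := by
      refine (le_abs_self _).trans ?_
      rw [abs_mul, ht]; exact mul_le_mul_of_nonneg_right hμ (by linarith)
    have h3 : t ^ 2 = (B + 1) ^ 2 := by rw [← sq_abs, ht]
    rw [h3]; linarith [h2, (by ring : (B + 1) ^ 2 = B ^ 2 + 2 * B + 1)]
  have b1 := hb (B + 1) (abs_of_nonneg (by linarith))
  have b2 := hb (-(B + 1)) (by rw [abs_neg]; exact abs_of_nonneg (by linarith))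
  linarith

/-- Monotonicity of the CDF alone suffices: `b` belongs to the set whose infimum is the quantile,
and `a` is a lower bound of that set. -/
lemma stdNormalQuantile_mem_Icc {a b u : ℝ} (ha : cdf (gaussianReal 0 1) a < u)
    (hb : u ≤ cdf (gaussianReal 0 1) b) : stdNormalQuantile u ∈ Set.Icc a b := by
  have hlow : ∀ x ∈ {x : ℝ | u ≤ cdf (gaussianReal 0 1) x}, a ≤ x := by
    intro x hx
    by_contra h
    exact absurd (hx.trans (monotone_cdf _ (not_le.1 h).le)) (not_le.2 ha)
  exact ⟨le_csInf ⟨b, hb⟩ hlow, csInf_le ⟨a, hlow⟩ hb⟩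

/-! ### Estimated transformations -/

section Empirical

variable {n p : ℕ} {X : Fin n → Fin p → ℝ} {Y : Fin n → ℝ}

lemma empCDFPlus_nonneg (j : Fin p) (x : ℝ) : 0 ≤ empCDFPlus X Y j x := by
  unfold empCDFPlus; positivity

lemma empCDFPlus_le_one (j : Fin p) (x : ℝ) : empCDFPlus X Y j x ≤ 1 := by
  apply div_le_one_of_le₀ _ (by positivity)
  exact_mod_cast Finset.card_le_card fun i hi => by
    simp only [Finset.mem_filter, Finset.mem_univ, true_and] at hi ⊢
    exact hi.1

lemma one_div_sq_le_half {N : ℕ} (hN : 2 ≤ N) : 1 / (N : ℝ) ^ 2 ≤ 1 / 2 := by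
  have : (2 : ℝ) ≤ N := by exact_mod_cast hN
  apply one_div_le_one_div_of_le <;> nlinarith

lemma winsorCDFPlus_mem_Icc (hN : 2 ≤ nPlus Y) (j : Fin p) (x : ℝ) :
    winsorCDFPlus X Y j x ∈ Set.Icc (1 / (nPlus Y : ℝ) ^ 2) (1 - 1 / (nPlus Y : ℝ) ^ 2) := by
  have := one_div_sq_le_half hN
  unfold winsorCDFPlus
  split_ifs with h1 h2
  · exact ⟨by linarith, le_rfl⟩
  · exact ⟨le_rfl, by linarith⟩
  · exact ⟨not_lt.1 h2, not_lt.1 h1⟩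

lemma abs_winsorCDFPlus_sub_le (j : Fin p) (x : ℝ) :
    |winsorCDFPlus X Y j x - empCDFPlus X Y j x| ≤ 1 / (nPlus Y : ℝ) ^ 2 := by
  have h0 := empCDFPlus_nonneg (X := X) (Y := Y) j x
  have h1 := empCDFPlus_le_one (X := X) (Y := Y) j x
  have h2 : 0 ≤ 1 / (nPlus Y : ℝ) ^ 2 := by positivity
  unfold winsorCDFPlus
  split_ifs <;> rw [abs_le] <;> constructor <;> linarith

/-- Winsorization keeps the argument of the quantile at distance `1 / n₊²` from `0` and `1`, farther
than the normal tails at `±H` reach. -/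
lemma abs_hHat_le (hN : 2 ≤ nPlus Y) {H : ℝ} (hH : 0 ≤ H)
    (hHN : Real.exp (-H ^ 2 / 2) < 1 / (nPlus Y : ℝ) ^ 2) (j : Fin p) (x : ℝ) :
    |hHat X Y j x| ≤ H := by
  have hw := winsorCDFPlus_mem_Icc (X := X) hN j x
  have h1 := cdf_gaussianReal_neg_le hH
  have h2 := one_sub_cdf_gaussianReal_le hH
  exact abs_le.2 (stdNormalQuantile_mem_Icc (by linarith [hw.1]) (by linarith [hw.2]))

lemma nPlus_eq_mul_sampleMean (hn : 0 < n) :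
    (nPlus Y : ℝ) = n * sampleMean (fun i => if Y i = 1 then (1 : ℝ) else 0) := by
  have : (n : ℝ) ≠ 0 := by positivity
  simp only [sampleMean, nPlus, Finset.sum_boole]; field_simp

lemma nMinus_eq_mul_sampleMean (hn : 0 < n) (hY : ∀ i, Y i = 1 ∨ Y i = -1) :
    (nMinus Y : ℝ) = n * (1 - sampleMean (fun i => if Y i = 1 then (1 : ℝ) else 0)) := by
  have h0 : (n : ℝ) ≠ 0 := by positivity
  have h1 : nPlus Y + nMinus Y = n := by
    have e : (Finset.univ.filter fun i => Y i = -1) = Finset.univ.filter fun i => ¬ Y i = 1 := by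
      ext i
      simp only [Finset.mem_filter, Finset.mem_univ, true_and]
      rcases hY i with h | h <;> rw [h] <;> norm_num
    rw [nPlus, nMinus, e, Finset.card_filter_add_card_filter_not]; simp
  have h2 : (nPlus Y : ℝ) + nMinus Y = n := by exact_mod_cast h1
  have := nPlus_eq_mul_sampleMean (Y := Y) hn
  linarith

/-- On the bulk `[-B, B]` the estimated transformation is uniformly close to the identity, if the
features are normal scores in the class `1` up to a monotone transformation. -/
lemma abs_hHat_sub_le (hn : 0 < n) {z : Fin n → Fin p → ℝ}
    (hord : ∀ i i' j, X i' j ≤ X i j ↔ z i' j ≤ z i j) {pr c ε B θ : ℝ} (hc : 0 < c)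
    (hε : 0 ≤ ε)
    (hq : c / 2 ≤ sampleMean fun i => if Y i = 1 then (1 : ℝ) else 0)
    (hqp : |(sampleMean fun i => if Y i = 1 then (1 : ℝ) else 0) - pr| ≤ ε)
    (hgrid : ∀ (j : Fin p) (m : ℤ), |m| ≤ (n : ℤ) ^ 2 →
      |(sampleMean fun i => if Y i = 1 ∧ z i j ≤ m / n then (1 : ℝ) else 0) -
        pr * cdf (gaussianReal 0 1) (m / n)| ≤ ε)
    (hBn : B + 1 ≤ n) (hθ1 : θ ≤ 1) (hθn : 1 / n ≤ θ)
    (hmain : 4 * ε / c + 4 / (c * n) ^ 2 < (θ - 1 / n) * (Real.exp (-(B + 1) ^ 2 / 2) / 3))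
    (i : Fin n) (j : Fin p) (hz : |z i j| ≤ B) :
    |hHat X Y j (X i j) - z i j| ≤ θ := by
  have hn' : (0 : ℝ) < n := by positivity
  set q := sampleMean fun i => if Y i = 1 then (1 : ℝ) else 0 with hqdef
  have hNq : (nPlus Y : ℝ) = n * q := nPlus_eq_mul_sampleMean hn
  have hqpos : 0 < q := by linarith
  have hNpos : (0 : ℝ) < nPlus Y := by rw [hNq]; positivity
  set F : ℝ → ℝ := fun t =>
    ((Finset.univ.filter fun i => Y i = 1 ∧ z i j ≤ t).card : ℝ) / (nPlus Y : ℝ) with hF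
  have hFmono : Monotone F := by
    intro s t hst
    apply div_le_div_of_nonneg_right _ hNpos.le
    exact_mod_cast Finset.card_le_card fun i hi => by
      simp only [Finset.mem_filter, Finset.mem_univ, true_and] at hi ⊢
      exact ⟨hi.1, hi.2.trans hst⟩
  -- Only the order of the observations enters, so the empirical CDF at a sample point can be
  -- computed from the normal scores.
  have hemp : empCDFPlus X Y j (X i j) = F (z i j) := by
    simp only [empCDFPlus, hF, hord]
  have hFgrid : ∀ m : ℤ, |m| ≤ (n : ℤ) ^ 2 →
      |F (m / n) - cdf (gaussianReal 0 1) (m / n)| ≤ 4 * ε / c := by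
    intro m hm
    have h1 := hgrid j m hm
    have h2 : (sampleMean fun i => if Y i = 1 ∧ z i j ≤ m / n then (1 : ℝ) else 0) =
        q * F (m / n) := by
      simp only [sampleMean, Finset.sum_boole, hF, hNq]; field_simp
    rw [h2] at h1
    have hc0 := cdf_nonneg (gaussianReal 0 1) ((m : ℝ) / n)
    have hc1 := cdf_le_one (gaussianReal 0 1) ((m : ℝ) / n)
    set Φ := cdf (gaussianReal 0 1) ((m : ℝ) / n)
    -- One `ε` comes from the joint frequency and one from the class frequency; dividing by `q ≥ c /
    -- 2` yields `4 * ε / c`.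
    have h3 : |q * (F (m / n) - Φ)| ≤ 2 * ε := by
      have e : q * (F (m / n) - Φ) = (q * F (m / n) - pr * Φ) - (q - pr) * Φ := by ring
      rw [e]
      refine (abs_sub _ _).trans ?_
      rw [abs_mul (q - pr), abs_of_nonneg hc0]
      nlinarith [abs_nonneg (q - pr)]
    rw [abs_mul, abs_of_pos hqpos] at h3
    rw [le_div_iff₀ hc]
    nlinarith [abs_nonneg (F (m / n) - Φ)]
  have hzB := abs_le.1 hz
  -- Enclose `z i j` between neighbouring points of the grid of mesh `1 / n`. Monotonicity of `F`
  -- transfers the grid bounds to `z i j`, at the price of `1 / n` in the argument.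
  set m : ℤ := ⌊z i j * n⌋ with hm
  have hm1 : (m : ℝ) ≤ z i j * n := Int.floor_le _
  have hm2 : z i j * n < m + 1 := Int.lt_floor_add_one _
  have hBn2 : B * n + 1 ≤ (n : ℝ) ^ 2 := by
    have : (1 : ℝ) ≤ n := by exact_mod_cast hn
    nlinarith
  have hzn : |z i j * n| ≤ B * n := by
    rw [abs_mul, abs_of_pos hn']; exact mul_le_mul_of_nonneg_right hz hn'.le
  have hzn' := abs_le.1 hzn
  have hmr : |m| ≤ (n : ℤ) ^ 2 := by
    have : |(m : ℝ)| ≤ (n : ℝ) ^ 2 := abs_le.2 ⟨by linarith, by linarith⟩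
    exact_mod_cast this
  have hmr' : |m + 1| ≤ (n : ℤ) ^ 2 := by
    have : |((m + 1 : ℤ) : ℝ)| ≤ (n : ℝ) ^ 2 := by
      push_cast; exact abs_le.2 ⟨by linarith, by linarith⟩
    exact_mod_cast this
  have hlo : (m : ℝ) / n ≤ z i j := by rw [div_le_iff₀ hn']; exact hm1
  have hhi : z i j ≤ ((m + 1 : ℤ) : ℝ) / n := by
    rw [le_div_iff₀ hn']; push_cast; exact hm2.le
  have hlo' : z i j - 1 / n ≤ (m : ℝ) / n := by
    rw [le_div_iff₀ hn', sub_mul, one_div, inv_mul_cancel₀ hn'.ne']; linarith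
  have hhi' : ((m + 1 : ℤ) : ℝ) / n ≤ z i j + 1 / n := by
    rw [div_le_iff₀ hn', add_mul, one_div, inv_mul_cancel₀ hn'.ne']; push_cast; linarith
  have hF1 : F (z i j) ≤ F (((m + 1 : ℤ) : ℝ) / n) := hFmono hhi
  have hF2 : F ((m : ℝ) / n) ≤ F (z i j) := hFmono hlo
  have hG1 := abs_le.1 (hFgrid (m + 1) hmr')
  have hG2 := abs_le.1 (hFgrid m hmr)
  have hinvn : (0 : ℝ) < 1 / n := by positivity
  have hepos : 0 < Real.exp (-(B + 1) ^ 2 / 2) / 3 := by positivity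
  have hD1 := cdf_gaussianReal_sub_ge (a := ((m + 1 : ℤ) : ℝ) / n) (b := z i j + θ) (r := B + 1)
    (by linarith) (by linarith) (by linarith)
  have hD2 := cdf_gaussianReal_sub_ge (a := z i j - θ) (b := (m : ℝ) / n) (r := B + 1)
    (by linarith) (by linarith) (by linarith)
  have hD1' : (θ - 1 / n) * (Real.exp (-(B + 1) ^ 2 / 2) / 3) ≤
      (z i j + θ - ((m + 1 : ℤ) : ℝ) / n) * (Real.exp (-(B + 1) ^ 2 / 2) / 3) :=
    mul_le_mul_of_nonneg_right (by linarith) hepos.le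
  have hD2' : (θ - 1 / n) * (Real.exp (-(B + 1) ^ 2 / 2) / 3) ≤
      ((m : ℝ) / n - (z i j - θ)) * (Real.exp (-(B + 1) ^ 2 / 2) / 3) :=
    mul_le_mul_of_nonneg_right (by linarith) hepos.le
  have hwin := abs_le.1 (abs_winsorCDFPlus_sub_le (X := X) (Y := Y) j (X i j))
  rw [hemp] at hwin
  -- The cost of Winsorization, with `n₊ ≥ c n / 2`.
  have hN2 : 1 / (nPlus Y : ℝ) ^ 2 ≤ 4 / (c * n) ^ 2 := by
    rw [hNq, div_le_div_iff₀ (by positivity) (by positivity)]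
    have h1 : c * n ≤ 2 * (n * q) := by linarith [mul_le_mul_of_nonneg_left hq hn'.le]
    have h2 := pow_le_pow_left₀ (by positivity : 0 ≤ c * n) h1 2
    rw [mul_pow 2] at h2
    linarith
  have hres := stdNormalQuantile_mem_Icc (a := z i j - θ) (b := z i j + θ)
    (u := winsorCDFPlus X Y j (X i j)) (by linarith) (by linarith)
  rw [hHat, abs_le]
  exact ⟨by linarith [hres.1], by linarith [hres.2]⟩

end Empirical

/-! ### Population moments and algebra of the model -/

lemma abs_mulVec_le_maxRowSum {m₁ m₂ : Type*} [Finite m₁] [Fintype m₂] (M : Matrix m₁ m₂ ℝ)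
    {w : m₂ → ℝ} {t : ℝ} (hw : ∀ k, |w k| ≤ t) (i : m₁) :
    |M.mulVec w i| ≤ maxRowSum M * t := by
  have h1 : |M.mulVec w i| ≤ (∑ k, |M i k|) * t := by
    rw [Matrix.mulVec, dotProduct, Finset.sum_mul]
    refine (Finset.abs_sum_le_sum_abs _ _).trans (Finset.sum_le_sum fun k _ => ?_)
    rw [abs_mul]; exact mul_le_mul_of_nonneg_left (hw k) (abs_nonneg _)
  have h2 : ∑ k, |M i k| ≤ maxRowSum M :=
    le_ciSup (f := fun i => ∑ k, |M i k|) (Set.finite_range _).bddAbove i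
  -- Without columns `hw` is vacuous and `t` may be negative, but both sides are then zero.
  rcases isEmpty_or_nonempty m₂ with h | ⟨⟨k⟩⟩
  · rw [Finset.univ_eq_empty, Finset.sum_empty] at h1 h2
    by_cases ht : 0 ≤ t
    · exact h1.trans (by rw [zero_mul]; positivity)
    · have e : maxRowSum M = 0 := by
        simp [maxRowSum]
      rw [e]; simpa using h1
  · exact h1.trans (mul_le_mul_of_nonneg_right h2 ((abs_nonneg _).trans (hw k)))

lemma maxRowSum_nonneg {m₁ m₂ : Type*} [Fintype m₂] (M : Matrix m₁ m₂ ℝ) : 0 ≤ maxRowSum M :=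
  Real.iSup_nonneg fun _ => Finset.sum_nonneg fun _ _ => abs_nonneg _

namespace SeLDAModel

variable {p : ℕ} (M : SeLDAModel p)

/-- The class-conditional law of the pair `(X, Y)`, given `Y = y`. -/
noncomputable def classLaw (y : ℝ) : Measure ((Fin p → ℝ) × ℝ) := M.law[|{z | z.2 = y}]

lemma measurableSet_label (y : ℝ) : MeasurableSet {z : (Fin p → ℝ) × ℝ | z.2 = y} :=
  measurableSet_eq_fun measurable_snd measurable_const

lemma restrict_eq_smul_classLaw {y : ℝ} (hy : M.law {z | z.2 = y} ≠ 0) :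
    M.law.restrict {z | z.2 = y} = M.law {z | z.2 = y} • M.classLaw y := by
  have := M.isProb
  rw [classLaw, ProbabilityTheory.cond, smul_smul, ENNReal.mul_inv_cancel hy (measure_ne_top _ _),
    one_smul]

lemma restrict_compl_plus :
    M.law.restrict {z | z.2 = 1}ᶜ = M.law.restrict {z | z.2 = -1} := by
  apply Measure.restrict_congr_set
  filter_upwards [M.label] with z hz
  apply propext
  change ¬ (z.2 = 1) ↔ z.2 = -1
  rcases hz with h | h <;> rw [h] <;> norm_num

lemma law_eq_add : M.law = M.law {z | z.2 = 1} • M.classLaw 1 +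
    M.law {z | z.2 = -1} • M.classLaw (-1) := by
  rw [← M.restrict_eq_smul_classLaw M.pos_plus, ← M.restrict_eq_smul_classLaw M.pos_minus,
    ← M.restrict_compl_plus, Measure.restrict_add_restrict_compl (measurableSet_label 1)]

lemma piPlus_add_piMinus : M.piPlus + M.piMinus = 1 := by
  have := M.isProb
  have h := M.restrict_compl_plus
  have h2 := congrArg (fun m => m Set.univ) h
  simp only [Measure.restrict_apply_univ] at h2
  rw [piMinus, measureReal_def, ← h2, ← measureReal_def,
    probReal_compl_eq_one_sub (measurableSet_label 1), piPlus]
  ring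

lemma piPlus_nonneg : 0 ≤ M.piPlus := measureReal_nonneg
lemma piMinus_nonneg : 0 ≤ M.piMinus := measureReal_nonneg

lemma isProbabilityMeasure_classLaw_one : IsProbabilityMeasure (M.classLaw 1) := by
  have := M.isProb; exact cond_isProbabilityMeasure M.pos_plus

lemma isProbabilityMeasure_classLaw_neg_one : IsProbabilityMeasure (M.classLaw (-1)) := by
  have := M.isProb; exact cond_isProbabilityMeasure M.pos_minus

lemma integrable_law {f : (Fin p → ℝ) × ℝ → ℝ} (h1 : Integrable f (M.classLaw 1))
    (h2 : Integrable f (M.classLaw (-1))) : Integrable f M.law := by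
  have := M.isProb
  rw [M.law_eq_add]
  exact (h1.smul_measure (measure_ne_top _ _)).add_measure (h2.smul_measure (measure_ne_top _ _))

lemma integral_law {f : (Fin p → ℝ) × ℝ → ℝ} (h1 : Integrable f (M.classLaw 1))
    (h2 : Integrable f (M.classLaw (-1))) :
    ∫ z, f z ∂M.law = M.piPlus * ∫ z, f z ∂M.classLaw 1 +
      M.piMinus * ∫ z, f z ∂M.classLaw (-1) := by
  have := M.isProb
  conv_lhs => rw [M.law_eq_add]
  rw [integral_add_measure (h1.smul_measure (measure_ne_top _ _))
    (h2.smul_measure (measure_ne_top _ _)), integral_smul_measure, integral_smul_measure]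
  rfl

lemma integral_law_plus (f : (Fin p → ℝ) × ℝ → ℝ) :
    ∫ z, (if z.2 = 1 then f z else 0) ∂M.law = M.piPlus * ∫ z, f z ∂M.classLaw 1 := by
  have e : (fun z : (Fin p → ℝ) × ℝ => if z.2 = 1 then f z else 0) =
      Set.indicator {z | z.2 = 1} f := by
    ext z; simp [Set.indicator_apply]
  rw [e, integral_indicator (measurableSet_label 1), M.restrict_eq_smul_classLaw M.pos_plus,
    integral_smul_measure]
  rfl

lemma hasLaw_plus (j : Fin p) :
    HasLaw (fun z : (Fin p → ℝ) × ℝ => M.h j (z.1 j)) (gaussianReal 0 1) (M.classLaw 1) := by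
  have h := (measurePreserving_eval_multivariateGaussian (μ := M.muPlus) M.posDef.posSemidef
    (i := j)).fun_comp_hasLaw M.law_plus
  rw [M.Sigma_diag, M.muPlus_eq] at h
  simpa [classLaw] using h

lemma hasLaw_minus (j : Fin p) :
    HasLaw (fun z : (Fin p → ℝ) × ℝ => M.h j (z.1 j)) (gaussianReal (-M.delta j) 1)
      (M.classLaw (-1)) := by
  have h := (measurePreserving_eval_multivariateGaussian (μ := M.muMinus) M.posDef.posSemidef
    (i := j)).fun_comp_hasLaw M.law_minus
  rw [M.Sigma_diag] at h
  have e : -M.delta j = M.muMinus j := by simp [delta, M.muPlus_eq]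
  rw [e]
  simpa [classLaw] using h

lemma cov_plus (j k : Fin p) : cov[fun z : (Fin p → ℝ) × ℝ => M.h j (z.1 j),
    fun z => M.h k (z.1 k); M.classLaw 1] = M.Sigma j k := by
  rw [← covariance_eval_multivariateGaussian (μ := M.muPlus) M.posDef.posSemidef j k]
  exact M.law_plus.covariance_fun_comp (f := fun x => x j) (g := fun x => x k)
    (by fun_prop) (by fun_prop)

lemma cov_minus (j k : Fin p) : cov[fun z : (Fin p → ℝ) × ℝ => M.h j (z.1 j),
    fun z => M.h k (z.1 k); M.classLaw (-1)] = M.Sigma j k := by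
  rw [← covariance_eval_multivariateGaussian (μ := M.muMinus) M.posDef.posSemidef j k]
  exact M.law_minus.covariance_fun_comp (f := fun x => x j) (g := fun x => x k)
    (by fun_prop) (by fun_prop)

lemma memLp_of_hasLaw_gaussianReal {Ω : Type*} [MeasurableSpace Ω] {P : Measure Ω} {f : Ω → ℝ}
    {m : ℝ} (h : HasLaw f (gaussianReal m 1) P) : MemLp f 2 P := by
  have := memLp_id_gaussianReal (μ := m) (v := 1) 2
  rw [← h.map_eq] at this
  exact (memLp_map_measure_iff (by rw [h.map_eq]; exact aestronglyMeasurable_id)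
    h.aemeasurable).1 (by simpa using this)

lemma aemeasurable_h (j : Fin p) :
    AEMeasurable (fun z : (Fin p → ℝ) × ℝ => M.h j (z.1 j)) M.law := by
  rw [M.law_eq_add]
  exact (aemeasurable_add_measure_iff).2 ⟨(M.hasLaw_plus j).aemeasurable.smul_measure _,
    (M.hasLaw_minus j).aemeasurable.smul_measure _⟩

lemma memLp_h (j : Fin p) : MemLp (fun z : (Fin p → ℝ) × ℝ => M.h j (z.1 j)) 2 M.law := by
  rw [memLp_two_iff_integrable_sq (M.aemeasurable_h j).aestronglyMeasurable]
  exact M.integrable_law (memLp_of_hasLaw_gaussianReal (M.hasLaw_plus j)).integrable_sq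
    (memLp_of_hasLaw_gaussianReal (M.hasLaw_minus j)).integrable_sq

lemma integral_h_plus (j : Fin p) : ∫ z, M.h j (z.1 j) ∂M.classLaw 1 = 0 := by
  have := (M.hasLaw_plus j).integral_eq
  rwa [integral_id_gaussianReal] at this

lemma integral_h_minus (j : Fin p) : ∫ z, M.h j (z.1 j) ∂M.classLaw (-1) = -M.delta j := by
  have := (M.hasLaw_minus j).integral_eq
  rwa [integral_id_gaussianReal] at this

lemma integral_h (j : Fin p) : ∫ z, M.h j (z.1 j) ∂M.law = -(M.piMinus * M.delta j) := by
  have := M.isProbabilityMeasure_classLaw_one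
  have := M.isProbabilityMeasure_classLaw_neg_one
  rw [M.integral_law ((memLp_of_hasLaw_gaussianReal (M.hasLaw_plus j)).integrable one_le_two)
    ((memLp_of_hasLaw_gaussianReal (M.hasLaw_minus j)).integrable one_le_two),
    M.integral_h_plus, M.integral_h_minus]
  ring

lemma integral_h_mul_h (j k : Fin p) : ∫ z, M.h j (z.1 j) * M.h k (z.1 k) ∂M.law =
    M.Sigma j k + M.piMinus * (M.delta j * M.delta k) := by
  have := M.isProbabilityMeasure_classLaw_one
  have := M.isProbabilityMeasure_classLaw_neg_one
  have p1 := fun j => memLp_of_hasLaw_gaussianReal (M.hasLaw_plus j)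
  have p2 := fun j => memLp_of_hasLaw_gaussianReal (M.hasLaw_minus j)
  rw [M.integral_law (f := fun z => M.h j (z.1 j) * M.h k (z.1 k)) ((p1 j).integrable_mul (p1 k))
    ((p2 j).integrable_mul (p2 k))]
  have h1 := covariance_eq_sub (p1 j) (p1 k)
  have h2 := covariance_eq_sub (p2 j) (p2 k)
  rw [M.cov_plus, M.integral_h_plus, M.integral_h_plus] at h1
  rw [M.cov_minus, M.integral_h_minus, M.integral_h_minus] at h2
  have e1 : ∫ z, M.h j (z.1 j) * M.h k (z.1 k) ∂M.classLaw 1 = M.Sigma j k := by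
    rw [h1]; simp
  have e2 : ∫ z, M.h j (z.1 j) * M.h k (z.1 k) ∂M.classLaw (-1) =
      M.Sigma j k + M.delta j * M.delta k := by
    rw [h2]; simp
  rw [e1, e2, mul_add, ← add_assoc, ← add_mul, M.piPlus_add_piMinus, one_mul]

lemma integral_h_mul_h_eq_Omega (j k : Fin p) : ∫ z, M.h j (z.1 j) * M.h k (z.1 k) ∂M.law =
    M.Omega j k + M.piMinus * M.delta j * (M.piMinus * M.delta k) := by
  have := M.isProb
  have h := covariance_eq_sub (M.memLp_h j) (M.memLp_h k)
  rw [M.integral_h, M.integral_h] at h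
  simp only [Omega, Matrix.of_apply]
  rw [h]; simp

/-- The law of total covariance: `Σ` within the classes, plus the covariance of the class means,
which take two values with probabilities `π₊` and `π₋`. -/
lemma Omega_apply (j k : Fin p) : M.Omega j k =
    M.Sigma j k + M.piPlus * M.piMinus * (M.delta j * M.delta k) := by
  have h1 := M.integral_h_mul_h j k
  rw [M.integral_h_mul_h_eq_Omega] at h1
  have h2 := M.piPlus_add_piMinus
  have h3 : M.piPlus = 1 - M.piMinus := by linarith
  rw [h3]; linarith

lemma Omega_eq : M.Omega = M.Sigma +
    (M.piPlus * M.piMinus) • Matrix.vecMulVec M.delta M.delta := by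
  ext j k
  simp [M.Omega_apply, Matrix.vecMulVec_apply]

lemma posDef_Omega : M.Omega.PosDef := by
  rw [M.Omega_eq]
  apply M.posDef.add_posSemidef
  apply Matrix.PosSemidef.smul _ (mul_nonneg M.piPlus_nonneg M.piMinus_nonneg)
  have := Matrix.posSemidef_vecMulVec_self_star (R := ℝ) M.delta
  simpa using this

lemma isUnit_det_Omega : IsUnit M.Omega.det := M.posDef_Omega.det_pos.ne'.isUnit

lemma Omega_mulVec_betaStar : M.Omega.mulVec M.betaStar = M.delta := by
  rw [betaStar, Matrix.mulVec_mulVec, Matrix.mul_nonsing_inv _ M.isUnit_det_Omega,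
    Matrix.one_mulVec]

/-- Sherman–Morrison: `Ω` is a rank-one update of `Σ` along `δ`, so `Ω` maps the Bayes direction to
a positive multiple of `δ`. Hence least squares and the Bayes rule select the same features. -/
lemma betaStar_eq_smul : ∃ a : ℝ, M.betaStar = a • M.betaBayes := by
  have hS : IsUnit M.Sigma.det := M.posDef.det_pos.ne'.isUnit
  have hB : M.Sigma.mulVec M.betaBayes = M.delta := by
    rw [betaBayes, Matrix.mulVec_mulVec, Matrix.mul_nonsing_inv _ hS, Matrix.one_mulVec]
  set q := M.delta ⬝ᵥ M.betaBayes with hq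
  have hq0 : 0 ≤ q := by
    have := M.posDef.posSemidef.dotProduct_mulVec_nonneg M.betaBayes
    rw [hB] at this
    rw [hq, dotProduct_comm]; simpa using this
  have hne : 1 + M.piPlus * M.piMinus * q ≠ 0 := by
    have := mul_nonneg (mul_nonneg M.piPlus_nonneg M.piMinus_nonneg) hq0
    positivity
  have hOm : M.Omega.mulVec M.betaBayes = (1 + M.piPlus * M.piMinus * q) • M.delta := by
    rw [M.Omega_eq, Matrix.add_mulVec, hB, Matrix.smul_mulVec, Matrix.vecMulVec_mulVec]
    ext j; simp [← hq]; ring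
  refine ⟨(1 + M.piPlus * M.piMinus * q)⁻¹, ?_⟩
  have : M.betaStar = M.Omega⁻¹.mulVec M.delta := rfl
  have h2 : M.delta = (1 + M.piPlus * M.piMinus * q)⁻¹ • M.Omega.mulVec M.betaBayes := by
    rw [hOm, smul_smul, inv_mul_cancel₀ hne, one_smul]
  rw [this]
  nth_rewrite 1 [h2]
  rw [Matrix.mulVec_smul, Matrix.mulVec_mulVec, Matrix.nonsing_inv_mul _ M.isUnit_det_Omega,
    Matrix.one_mulVec]

lemma betaStar_eq_zero {j : Fin p} (hj : j ∉ M.A) : M.betaStar j = 0 := by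
  obtain ⟨a, ha⟩ := M.betaStar_eq_smul
  have : M.betaBayes j = 0 := by simpa [A] using hj
  rw [ha]; simp [this]

lemma sum_eq_sum_subtype {v : Fin p → ℝ} (hv : ∀ k ∉ M.A, v k = 0) (f : Fin p → ℝ) :
    ∑ k, f k * v k = ∑ k : {j // j ∈ M.A}, f k * v k := by
  rw [← sum_mul_dite_mem M.A f fun k => v k]
  refine Finset.sum_congr rfl fun k _ => ?_
  by_cases hk : k ∈ M.A <;> simp [hk, hv k]

lemma isUnit_det_OmegaAA : IsUnit M.OmegaAA.det :=
  (M.posDef_Omega.submatrix Subtype.val_injective).det_pos.ne'.isUnit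

/-- Recover `v` on `A` by applying `Ω_AA⁻¹`. Stated for vectors supported on `A`, this is the form
in which `φ` enters the lasso argument. -/
lemma abs_le_varphi_mul (v : Fin p → ℝ) (t : ℝ) (hv : ∀ k ∉ M.A, v k = 0)
    (h : ∀ j ∈ M.A, |∑ k, M.Omega j k * v k| ≤ t) : ∀ j ∈ M.A, |v j| ≤ M.varphi * t := by
  intro j hj
  have h1 := abs_mulVec_le_maxRowSum M.OmegaAA⁻¹
    (w := M.OmegaAA.mulVec fun k : {j // j ∈ M.A} => v k) (t := t) (fun k => by
      have := h k k.2
      rw [M.sum_eq_sum_subtype hv] at this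
      exact this) ⟨j, hj⟩
  rw [Matrix.mulVec_mulVec, Matrix.nonsing_inv_mul _ M.isUnit_det_OmegaAA, Matrix.one_mulVec] at h1
  exact h1

lemma abs_le_kappa_mul (v : Fin p → ℝ) (t : ℝ) (hv : ∀ k ∉ M.A, v k = 0)
    (h : ∀ j ∈ M.A, |∑ k, M.Omega j k * v k| ≤ t) :
    ∀ j ∉ M.A, |∑ k, M.Omega j k * v k| ≤ M.kappa * t := by
  intro j hj
  have h1 := abs_mulVec_le_maxRowSum (M.OmegaAcA * M.OmegaAA⁻¹)
    (w := M.OmegaAA.mulVec fun k : {j // j ∈ M.A} => v k) (t := t) (fun k => by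
      have := h k k.2
      rw [M.sum_eq_sum_subtype hv] at this
      exact this) ⟨j, hj⟩
  rw [Matrix.mulVec_mulVec, Matrix.mul_assoc, Matrix.nonsing_inv_mul _ M.isUnit_det_OmegaAA,
    Matrix.mul_one] at h1
  rw [M.sum_eq_sum_subtype hv]
  exact h1

lemma varphi_nonneg : 0 ≤ M.varphi := maxRowSum_nonneg _

lemma sum_Omega_mul_betaStar (j : Fin p) : ∑ k, M.Omega j k * M.betaStar k = M.delta j :=
  congrFun M.Omega_mulVec_betaStar j

lemma abs_delta_le_Delta {j : Fin p} (hj : j ∈ M.A) : |M.delta j| ≤ M.Delta :=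
  norm_le_pi_norm (fun j : {j // j ∈ M.A} => M.delta j) ⟨j, hj⟩

lemma Delta_nonneg : 0 ≤ M.Delta := norm_nonneg _

/-- As `β` is supported on `A`, `δ` off `A` equals `Ω_{AᶜA} Ω_AA⁻¹ δ_A`. So irrepresentability
extends the bound on the mean differences from `A` to all features. -/
lemma abs_delta_le (hk : M.kappa ≤ 1) (j : Fin p) : |M.delta j| ≤ M.Delta := by
  by_cases hj : j ∈ M.A
  · exact M.abs_delta_le_Delta hj
  · have := M.abs_le_kappa_mul M.betaStar M.Delta (fun k hk => M.betaStar_eq_zero hk)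
      (fun j hj => by rw [M.sum_Omega_mul_betaStar]; exact M.abs_delta_le_Delta hj) j hj
    rw [M.sum_Omega_mul_betaStar] at this
    nlinarith [M.Delta_nonneg]

lemma abs_betaStar_le {j : Fin p} (hj : j ∈ M.A) : |M.betaStar j| ≤ M.varphi * M.Delta :=
  M.abs_le_varphi_mul M.betaStar M.Delta (fun k hk => M.betaStar_eq_zero hk)
    (fun j hj => by rw [M.sum_Omega_mul_betaStar]; exact M.abs_delta_le_Delta hj) j hj

lemma minBeta_nonneg : 0 ≤ M.minBeta := Real.iInf_nonneg fun _ => abs_nonneg _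

lemma minBeta_le {j : Fin p} (hj : j ∈ M.A) : M.minBeta ≤ |M.betaStar j| :=
  ciInf_le (f := fun j : {j // j ∈ M.A} => |M.betaStar j|) (Set.finite_range _).bddBelow ⟨j, hj⟩

end SeLDAModel

/-! ### Truncated scores and their expectations -/

/-- Truncation of a real number to `[-B, B]`. -/
def clip (B z : ℝ) : ℝ := max (-B) (min z B)

/-- The square of `z` outside `[-B, B]`, and `0` inside. -/
noncomputable def tailSq (B z : ℝ) : ℝ := if B < |z| then z ^ 2 else 0

lemma measurable_clip (B : ℝ) : Measurable (clip B) := by unfold clip; fun_prop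

lemma measurable_tailSq (B : ℝ) : Measurable (tailSq B) := by
  unfold tailSq
  exact Measurable.ite (measurableSet_lt (by fun_prop) (by fun_prop)) (by fun_prop) (by fun_prop)

lemma tailSq_nonneg (B z : ℝ) : 0 ≤ tailSq B z := by unfold tailSq; split_ifs <;> positivity

lemma tailSq_le_sq (B z : ℝ) : tailSq B z ≤ z ^ 2 := by
  unfold tailSq; split_ifs; exacts [le_rfl, by positivity]

lemma clip_of_abs_le {B z : ℝ} (h : |z| ≤ B) : clip B z = z := by
  have := abs_le.1 h
  rw [clip, min_eq_left this.2, max_eq_right this.1]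

lemma abs_clip_le {B : ℝ} (hB : 0 ≤ B) (z : ℝ) : |clip B z| ≤ B := by
  rw [abs_le, clip]
  exact ⟨le_max_left _ _, max_le (by linarith) (min_le_right _ _)⟩

lemma abs_clip_le_abs {B : ℝ} (hB : 0 ≤ B) (z : ℝ) : |clip B z| ≤ |z| := by
  by_cases h : |z| ≤ B
  · rw [clip_of_abs_le h]
  · exact (abs_clip_le hB z).trans (not_le.1 h).le

lemma clip_mul_nonneg {B : ℝ} (hB : 0 ≤ B) (z : ℝ) : 0 ≤ clip B z * z := by
  rcases le_total 0 z with h | h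
  · exact mul_nonneg (le_max_of_le_right (le_min h hB)) h
  · exact mul_nonneg_of_nonpos_of_nonpos (max_le (by linarith) ((min_le_left _ _).trans h)) h

lemma abs_sub_clip_le {B : ℝ} (hB : 1 ≤ B) (z : ℝ) : |z - clip B z| ≤ tailSq B z := by
  unfold tailSq
  split_ifs with h
  · have h1 : |z - clip B z| ≤ |z| := by
      rw [← sq_le_sq]
      have h2 := clip_mul_nonneg (by linarith : 0 ≤ B) z
      rcases le_total 0 z with hz | hz
      · have h3 : clip B z ≤ z := (le_abs_self _).trans
          ((abs_clip_le_abs (by linarith) z).trans (abs_of_nonneg hz).le)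
        have h4 : 0 ≤ clip B z := le_max_of_le_right (le_min hz (by linarith))
        nlinarith
      · have h3 : z ≤ clip B z := by
          have := (neg_abs_le (clip B z)).trans'
            (neg_le_neg (abs_clip_le_abs (by linarith : 0 ≤ B) z))
          rw [abs_of_nonpos hz] at this; linarith
        have h4 : clip B z ≤ 0 := max_le (by linarith) ((min_le_left _ _).trans hz)
        nlinarith
    rw [← sq_abs]; nlinarith
  · rw [clip_of_abs_le (not_lt.1 h)]; simp

/-- Clipping preserves signs and shrinks, so the product moves by at most `|z w|`, and only if some
factor exceeds `B`. Then `|z w|` is at most the square of the larger factor, which a tail term pays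
for. -/
lemma abs_mul_sub_clip_mul_clip_le {B : ℝ} (hB : 0 ≤ B) (z w : ℝ) :
    |z * w - clip B z * clip B w| ≤ tailSq B z + tailSq B w := by
  by_cases h : |z| ≤ B ∧ |w| ≤ B
  · rw [clip_of_abs_le h.1, clip_of_abs_le h.2, sub_self, abs_zero]
    exact add_nonneg (tailSq_nonneg _ _) (tailSq_nonneg _ _)
  have hz := abs_clip_le_abs hB z
  have hw := abs_clip_le_abs hB w
  have hnn : 0 ≤ (z * w) * (clip B z * clip B w) := by
    have := mul_nonneg (clip_mul_nonneg hB z) (clip_mul_nonneg hB w)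
    nlinarith
  have hle : |clip B z * clip B w| ≤ |z * w| := by
    rw [abs_mul, abs_mul]; exact mul_le_mul hz hw (abs_nonneg _) (abs_nonneg _)
  have h1 : |z * w - clip B z * clip B w| ≤ |z * w| := by
    apply abs_le_of_sq_le_sq _ (abs_nonneg _)
    rw [sq_abs]
    have h2 : (clip B z * clip B w) ^ 2 ≤ (z * w) * (clip B z * clip B w) := by
      rw [← abs_of_nonneg hnn, abs_mul, ← sq_abs (clip B z * clip B w), sq]
      exact mul_le_mul_of_nonneg_right hle (abs_nonneg _)
    nlinarith
  refine h1.trans ?_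
  rw [abs_mul]
  have h0 := abs_nonneg z
  have h0' := abs_nonneg w
  unfold tailSq
  rw [← sq_abs z, ← sq_abs w]
  split_ifs with a b b
  · nlinarith [sq_nonneg (|z| - |w|)]
  · nlinarith [not_lt.1 b]
  · nlinarith [not_lt.1 a]
  · exact absurd ⟨not_lt.1 a, not_lt.1 b⟩ h

lemma ite_abs_le_tailSq {B : ℝ} (hB : 1 ≤ B) (z : ℝ) :
    (if B < |z| then (1 : ℝ) else 0) ≤ tailSq B z := by
  unfold tailSq
  split_ifs with h
  · rw [← sq_abs]; nlinarith
  · exact le_rfl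

lemma abs_integral_sub_integral_le {Ω : Type*} [MeasurableSpace Ω] {P : Measure Ω} {f g k : Ω → ℝ}
    (hf : Integrable f P) (hg : Integrable g P) (hk : Integrable k P)
    (h : ∀ z, |f z - g z| ≤ k z) : |∫ z, f z ∂P - ∫ z, g z ∂P| ≤ ∫ z, k z ∂P := by
  rw [← integral_sub hf hg]
  exact (abs_integral_le_integral_abs).trans (integral_mono (hf.sub hg).abs hk h)

/-- Bound for the truncated second moment of a normal variable whose mean is at most `C` in absolute
value and whose variance is one. -/
noncomputable def tailBound (C B : ℝ) : ℝ := 4 * Real.exp (-B ^ 2 / 2 + (C + 1) * B + C + 1 / 2)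

namespace SeLDAModel

variable {p : ℕ} (M : SeLDAModel p)

lemma integrable_sq_h (j : Fin p) : Integrable (fun z => M.h j (z.1 j) ^ 2) M.law :=
  (M.memLp_h j).integrable_sq

lemma integrable_h (j : Fin p) : Integrable (fun z => M.h j (z.1 j)) M.law := by
  have := M.isProb
  exact (M.memLp_h j).integrable one_le_two

lemma integrable_tailSq (B : ℝ) (j : Fin p) :
    Integrable (fun z => tailSq B (M.h j (z.1 j))) M.law := by
  refine (M.integrable_sq_h j).mono'
    ((measurable_tailSq B).comp_aemeasurable (M.aemeasurable_h j)).aestronglyMeasurable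
    (Filter.Eventually.of_forall fun z => ?_)
  rw [Real.norm_of_nonneg (tailSq_nonneg _ _)]; exact tailSq_le_sq _ _

lemma integral_tailSq_le {B C : ℝ} (hB : 0 ≤ B) {j : Fin p} (hC : |M.delta j| ≤ C) :
    ∫ z, tailSq B (M.h j (z.1 j)) ∂M.law ≤ tailBound C B := by
  have hC0 : 0 ≤ C := (abs_nonneg _).trans hC
  have hgen : ∀ (y m : ℝ), HasLaw (fun z : (Fin p → ℝ) × ℝ => M.h j (z.1 j)) (gaussianReal m 1)
      (M.classLaw y) → |m| ≤ C → Integrable (fun z => tailSq B (M.h j (z.1 j))) (M.classLaw y) ∧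
      ∫ z, tailSq B (M.h j (z.1 j)) ∂M.classLaw y ≤ tailBound C B := by
    intro y m hl hm
    constructor
    · refine (memLp_of_hasLaw_gaussianReal hl).integrable_sq.mono'
        ((measurable_tailSq B).comp_aemeasurable hl.aemeasurable).aestronglyMeasurable
        (Filter.Eventually.of_forall fun z => ?_)
      rw [Real.norm_of_nonneg (tailSq_nonneg _ _)]; exact tailSq_le_sq _ _
    · have h1 := hl.integral_comp (measurable_tailSq B).aestronglyMeasurable
      have h2 := integral_sq_indicator_gaussianReal_le hB hm
      exact h1.trans_le h2
  obtain ⟨i1, b1⟩ := hgen 1 0 (M.hasLaw_plus j) (by simpa using hC0)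
  obtain ⟨i2, b2⟩ := hgen (-1) _ (M.hasLaw_minus j) (by rwa [abs_neg])
  rw [M.integral_law i1 i2]
  have h1 := mul_le_mul_of_nonneg_left b1 M.piPlus_nonneg
  have h2 := mul_le_mul_of_nonneg_left b2 M.piMinus_nonneg
  calc _ ≤ (M.piPlus + M.piMinus) * tailBound C B := by linarith
    _ = _ := by rw [M.piPlus_add_piMinus, one_mul]

lemma integrable_of_abs_le {f : (Fin p → ℝ) × ℝ → ℝ} (hf : AEMeasurable f M.law) {b : ℝ}
    (hb : ∀ z, |f z| ≤ b) : Integrable f M.law := by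
  have := M.isProb
  exact Integrable.of_bound hf.aestronglyMeasurable b (Filter.Eventually.of_forall hb)

lemma aemeasurable_clip (B : ℝ) (j : Fin p) :
    AEMeasurable (fun z => clip B (M.h j (z.1 j))) M.law :=
  (measurable_clip B).comp_aemeasurable (M.aemeasurable_h j)

lemma integral_plus : ∫ z : (Fin p → ℝ) × ℝ, (if z.2 = 1 then (1 : ℝ) else 0) ∂M.law =
    M.piPlus := by
  have := M.isProbabilityMeasure_classLaw_one
  rw [M.integral_law_plus]; simp

lemma integral_plus_le (j : Fin p) (t : ℝ) :
    ∫ z, (if z.2 = 1 ∧ M.h j (z.1 j) ≤ t then (1 : ℝ) else 0) ∂M.law =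
      M.piPlus * cdf (gaussianReal 0 1) t := by
  have := M.isProbabilityMeasure_classLaw_one
  have e : ∀ z : (Fin p → ℝ) × ℝ, (if z.2 = 1 ∧ M.h j (z.1 j) ≤ t then (1 : ℝ) else 0) =
      if z.2 = 1 then (if M.h j (z.1 j) ≤ t then 1 else 0) else 0 := by
    intro z; split_ifs <;> simp_all
  simp only [e]
  rw [M.integral_law_plus, cdf_eq_real]
  congr 1
  have h := (M.hasLaw_plus j).integral_comp (f := Set.indicator (Set.Iic t) (1 : ℝ → ℝ))
    ((measurable_one.indicator measurableSet_Iic).aestronglyMeasurable)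
  rw [integral_indicator_one measurableSet_Iic] at h
  rw [← h]
  congr 1

lemma integral_tail_le {B C : ℝ} (hB : 1 ≤ B) {j : Fin p} (hC : |M.delta j| ≤ C) :
    ∫ z, (if B < |M.h j (z.1 j)| then (1 : ℝ) else 0) ∂M.law ≤ tailBound C B := by
  refine le_trans ?_ (M.integral_tailSq_le (by linarith) hC)
  exact integral_mono_of_nonneg (Filter.Eventually.of_forall fun z => by
      simp only [Pi.zero_apply]; split_ifs <;> norm_num)
    (M.integrable_tailSq B j) (Filter.Eventually.of_forall fun z => ite_abs_le_tailSq hB _)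

lemma abs_integral_clip_add_le {B C : ℝ} (hB : 1 ≤ B) {j : Fin p} (hC : |M.delta j| ≤ C) :
    |∫ z, clip B (M.h j (z.1 j)) ∂M.law + M.piMinus * M.delta j| ≤ tailBound C B := by
  have e : M.piMinus * M.delta j = -∫ z, M.h j (z.1 j) ∂M.law := by rw [M.integral_h]; ring
  rw [e, ← sub_eq_add_neg]
  refine le_trans ?_ (M.integral_tailSq_le (by linarith) hC)
  exact abs_integral_sub_integral_le
    (M.integrable_of_abs_le (M.aemeasurable_clip B j) fun z => abs_clip_le (by linarith) _)
    (M.integrable_h j) (M.integrable_tailSq B j)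
    fun z => by rw [abs_sub_comm]; exact abs_sub_clip_le hB _

lemma abs_integral_plus_clip_le {B C : ℝ} (hB : 1 ≤ B) {j : Fin p} (hC : |M.delta j| ≤ C) :
    |∫ z, (if z.2 = 1 then clip B (M.h j (z.1 j)) else 0) ∂M.law| ≤ tailBound C B := by
  have e : ∫ z, (if z.2 = 1 then M.h j (z.1 j) else 0) ∂M.law = 0 := by
    rw [M.integral_law_plus, M.integral_h_plus, mul_zero]
  suffices h : |∫ z, (if z.2 = 1 then clip B (M.h j (z.1 j)) else 0) ∂M.law -
      ∫ z, (if z.2 = 1 then M.h j (z.1 j) else 0) ∂M.law| ≤ tailBound C B by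
    rwa [e, sub_zero] at h
  refine le_trans ?_ (M.integral_tailSq_le (by linarith) hC)
  have hind : ∀ f : (Fin p → ℝ) × ℝ → ℝ, Integrable f M.law →
      Integrable (fun z => if z.2 = 1 then f z else 0) M.law := by
    intro f hf
    have e : (fun z : (Fin p → ℝ) × ℝ => if z.2 = 1 then f z else 0) =
        Set.indicator {z | z.2 = 1} f := by
      ext z; simp [Set.indicator_apply]
    rw [e]; exact hf.indicator (measurableSet_label 1)
  refine abs_integral_sub_integral_le
    (hind _ (M.integrable_of_abs_le (M.aemeasurable_clip B j) fun z => abs_clip_le (by linarith) _))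
    (hind _ (M.integrable_h j)) (M.integrable_tailSq B j) fun z => ?_
  split_ifs
  · rw [abs_sub_comm]; exact abs_sub_clip_le hB _
  · rw [sub_zero, abs_zero]; exact tailSq_nonneg _ _

lemma abs_integral_clip_mul_clip_sub_le {B C : ℝ} (hB : 0 ≤ B) {j k : Fin p}
    (hj : |M.delta j| ≤ C) (hk : |M.delta k| ≤ C) :
    |∫ z, clip B (M.h j (z.1 j)) * clip B (M.h k (z.1 k)) ∂M.law -
      (M.Omega j k + M.piMinus * M.delta j * (M.piMinus * M.delta k))| ≤ 2 * tailBound C B := by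
  rw [← M.integral_h_mul_h_eq_Omega]
  have hb := M.integral_tailSq_le hB hj
  have hb' := M.integral_tailSq_le hB hk
  have h := abs_integral_sub_integral_le (P := M.law)
    (f := fun z => clip B (M.h j (z.1 j)) * clip B (M.h k (z.1 k)))
    (g := fun z => M.h j (z.1 j) * M.h k (z.1 k))
    (k := fun z => tailSq B (M.h j (z.1 j)) + tailSq B (M.h k (z.1 k)))
    (M.integrable_of_abs_le ((M.aemeasurable_clip B j).mul (M.aemeasurable_clip B k))
      (b := B * B) fun z => by
        rw [abs_mul]
        exact mul_le_mul (abs_clip_le hB _) (abs_clip_le hB _) (abs_nonneg _) hB)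
    ((M.memLp_h j).integrable_mul (M.memLp_h k))
    ((M.integrable_tailSq B j).add (M.integrable_tailSq B k))
    fun z => by rw [abs_sub_comm]; exact abs_mul_sub_clip_mul_clip_le hB _ _
  rw [integral_add (M.integrable_tailSq B j) (M.integrable_tailSq B k)] at h
  linarith

end SeLDAModel

/-! ### From score errors to covariance errors -/

section Deterministic

variable {n : ℕ} {x z w : Fin n → ℝ} {H B θ τ ε : ℝ}

/-- Accurate in the bulk, merely bounded outside: there the error is at most `H + B ≤ 2 H`, and is
averaged against the small fraction of such observations. -/
lemma abs_sub_clip_le_ite (hBH : B ≤ H) (hB : 0 ≤ B) {a b : ℝ} (hθ : 0 ≤ θ)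
    (ha : |a| ≤ H) (hab : |b| ≤ B → |a - b| ≤ θ) :
    |a - clip B b| ≤ θ + 2 * H * (if B < |b| then 1 else 0) := by
  split_ifs with h
  · have h1 := abs_sub a (clip B b)
    have h2 := abs_clip_le hB b
    linarith
  · rw [clip_of_abs_le (not_lt.1 h)]
    simpa using hab (not_lt.1 h)

/-- Averages of the estimated scores are close to averages of the truncated true scores. -/
lemma abs_sampleMean_mul_sub_clip_le (hn : 0 < n) (hBH : B ≤ H) (hB : 0 ≤ B)
    (hθ : 0 ≤ θ) (hx : ∀ i, |x i| ≤ H) (hxz : ∀ i, |z i| ≤ B → |x i - z i| ≤ θ)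
    (hfr : (sampleMean fun i => if B < |z i| then (1 : ℝ) else 0) ≤ τ + ε) {a : ℝ} (ha : 0 ≤ a)
    (hw : ∀ i, |w i| ≤ a) :
    |(sampleMean fun i => w i * x i) - sampleMean fun i => w i * clip B (z i)| ≤
      a * (θ + 2 * H * (τ + ε)) := by
  rw [← sampleMean_sub]
  refine (abs_sampleMean_le _).trans ?_
  have h1 : ∀ i, |w i * x i - w i * clip B (z i)| ≤
      a * (θ + 2 * H * (if B < |z i| then 1 else 0)) := by
    intro i
    rw [← mul_sub, abs_mul]
    exact mul_le_mul (hw i) (abs_sub_clip_le_ite hBH hB hθ (hx i) (hxz i)) (abs_nonneg _) ha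
  refine (sampleMean_mono h1).trans ?_
  rw [sampleMean_const_mul, sampleMean_add, sampleMean_const hn, sampleMean_const_mul]
  apply mul_le_mul_of_nonneg_left _ ha
  have := mul_le_mul_of_nonneg_left hfr (by linarith : 0 ≤ 2 * H)
  linarith

end Deterministic

/-- Error bounds for the sample covariances, from error bounds for the first and second sample
moments. -/
lemma abs_sampleCov_sub_le {n : ℕ} {f g : Fin n → ℝ} {D C a b Om : ℝ}
    (hD : D ≤ 1) (hb : |b| ≤ C) (ha : |a| ≤ C)
    (hf : |sampleMean f + a| ≤ D) (hg : |sampleMean g + b| ≤ D)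
    (hfg : |(sampleMean fun i => f i * g i) - (Om + a * b)| ≤ D) :
    |sampleCov f g - Om| ≤ (2 * C + 2) * D := by
  have hD0 : 0 ≤ D := (abs_nonneg _).trans hf
  have e : sampleCov f g - Om = ((sampleMean fun i => f i * g i) - (Om + a * b)) -
      (sampleMean f + a) * (sampleMean g + b) + (sampleMean f + a) * b +
      a * (sampleMean g + b) := by
    rw [sampleCov]; ring
  rw [e]
  have h1 : |(sampleMean f + a) * (sampleMean g + b)| ≤ D * 1 := by
    rw [abs_mul]; exact mul_le_mul hf (hg.trans hD) (abs_nonneg _) hD0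
  have h2 : |(sampleMean f + a) * b| ≤ D * C := by
    rw [abs_mul]; exact mul_le_mul hf hb (abs_nonneg _) hD0
  have h3 : |a * (sampleMean g + b)| ≤ C * D := by
    rw [abs_mul]; exact mul_le_mul ha hg (abs_nonneg _) ((abs_nonneg _).trans ha)
  rw [abs_le] at *
  constructor <;> linarith [h1.1, h1.2, h2.1, h2.2, h3.1, h3.2, hfg.1, hfg.2]

/-! ### Covariances with the label codings -/

section Labels

variable {n : ℕ} {Y f : Fin n → ℝ} {D C d ε π₁ π₂ : ℝ}

/-- The score has mean `0` in the class `1` and overall mean `-π₂ d`, so its covariance with the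
class indicator is `π₁ π₂ d`. Both codings are affine functions of this indicator. -/
lemma abs_mean_plus_sub_le (hπ : π₁ + π₂ = 1) (hπ₂ : 0 ≤ π₂) (hπ₁ : 0 ≤ π₁)
    (hq : |(sampleMean fun i => if Y i = 1 then (1 : ℝ) else 0) - π₁| ≤ ε)
    (hq1 : (sampleMean fun i => if Y i = 1 then (1 : ℝ) else 0) ≤ 1)
    (hq0 : 0 ≤ sampleMean fun i => if Y i = 1 then (1 : ℝ) else 0)
    (hεD : ε ≤ D) (hd : |d| ≤ C)
    (hf : |sampleMean f + π₂ * d| ≤ D)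
    (hv : |sampleMean fun i => if Y i = 1 then f i else 0| ≤ D) :
    |(sampleMean fun i => if Y i = 1 then f i else 0) -
      sampleMean f * (sampleMean fun i => if Y i = 1 then (1 : ℝ) else 0) - π₁ * π₂ * d| ≤
      (2 + C) * D := by
  set q := sampleMean fun i => if Y i = 1 then (1 : ℝ) else 0
  set v := sampleMean fun i => if Y i = 1 then f i else 0
  have hD0 : 0 ≤ D := (abs_nonneg _).trans hf
  have hC0 : 0 ≤ C := (abs_nonneg _).trans hd
  have e : v - sampleMean f * q - π₁ * π₂ * d =
      v - (sampleMean f + π₂ * d) * q + (π₂ * d) * (q - π₁) := by ring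
  rw [e]
  have h1 : |(sampleMean f + π₂ * d) * q| ≤ D * 1 := by
    rw [abs_mul]
    exact mul_le_mul hf (abs_le.2 ⟨by linarith, hq1⟩) (abs_nonneg _) hD0
  have h2 : |(π₂ * d) * (q - π₁)| ≤ C * D := by
    rw [abs_mul, abs_mul, abs_of_nonneg hπ₂]
    refine mul_le_mul ?_ (hq.trans hεD) (abs_nonneg _) hC0
    calc π₂ * |d| ≤ 1 * |d| := mul_le_mul_of_nonneg_right (by linarith) (abs_nonneg _)
      _ ≤ C := by linarith
  rw [abs_le] at *
  constructor <;> linarith [h1.1, h1.2, h2.1, h2.2, hv.1, hv.2]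

lemma sampleCov_label (hn : 0 < n) (hY : ∀ i, Y i = 1 ∨ Y i = -1) :
    sampleCov f Y = 2 * ((sampleMean fun i => if Y i = 1 then f i else 0) -
      sampleMean f * sampleMean fun i => if Y i = 1 then (1 : ℝ) else 0) := by
  have e1 : (fun i => f i * Y i) = fun i => 2 * (if Y i = 1 then f i else 0) - f i := by
    funext i; rcases hY i with h | h <;> rw [h] <;> norm_num; ring
  have e2 : sampleMean Y = 2 * (sampleMean fun i => if Y i = 1 then (1 : ℝ) else 0) - 1 := by
    have e : sampleMean Y = sampleMean fun i => 2 * (if Y i = 1 then (1 : ℝ) else 0) - 1 := by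
      congr 1
      funext i; rcases hY i with h | h <;> rw [h] <;> norm_num
    rw [e, sampleMean_sub, sampleMean_const_mul, sampleMean_const hn]
  rw [sampleCov, e1, sampleMean_sub, sampleMean_const_mul, e2]
  ring

/-- The centered coding is affine in the class indicator with slope `1 / (q (1 - q))`, the
reciprocal of the sample variance of the indicator. This normalization removes the factor `π₊ π₋`.
-/
lemma sampleCov_centeredLabels (hn : 0 < n) (hY : ∀ i, Y i = 1 ∨ Y i = -1)
    (hq0 : 0 < sampleMean fun i => if Y i = 1 then (1 : ℝ) else 0)
    (hq1 : (sampleMean fun i => if Y i = 1 then (1 : ℝ) else 0) < 1) :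
    sampleCov f (centeredLabels Y) = ((sampleMean fun i => if Y i = 1 then f i else 0) -
      sampleMean f * sampleMean fun i => if Y i = 1 then (1 : ℝ) else 0) /
      ((sampleMean fun i => if Y i = 1 then (1 : ℝ) else 0) *
        (1 - sampleMean fun i => if Y i = 1 then (1 : ℝ) else 0)) := by
  have hn' : (n : ℝ) ≠ 0 := by positivity
  set q := sampleMean fun i => if Y i = 1 then (1 : ℝ) else 0 with hq
  have hq' : 1 - q ≠ 0 := by linarith
  have hc : centeredLabels Y = fun i => (if Y i = 1 then (1 : ℝ) else 0) * (q * (1 - q))⁻¹ -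
      (1 - q)⁻¹ := by
    funext i
    simp only [centeredLabels, nPlus_eq_mul_sampleMean hn, nMinus_eq_mul_sampleMean hn hY, ← hq]
    split_ifs
    · field_simp
    · field_simp; simp
  have e1 : (fun i => f i * centeredLabels Y i) =
      fun i => (if Y i = 1 then f i else 0) * (q * (1 - q))⁻¹ - f i * (1 - q)⁻¹ := by
    rw [hc]; funext i; by_cases h : Y i = 1 <;> simp only [h, if_true, if_false] <;> ring
  have e2 : sampleMean (centeredLabels Y) = 0 := by
    rw [hc, sampleMean_sub, sampleMean_mul_const, sampleMean_const hn, ← hq]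
    field_simp; ring
  rw [sampleCov, e1, e2, sampleMean_sub, sampleMean_mul_const, sampleMean_mul_const]
  field_simp; ring

lemma abs_sampleCov_label_sub_le (hn : 0 < n) (hY : ∀ i, Y i = 1 ∨ Y i = -1)
    (hπ : π₁ + π₂ = 1) (hπ₂ : 0 ≤ π₂) (hπ₁ : 0 ≤ π₁)
    (hq : |(sampleMean fun i => if Y i = 1 then (1 : ℝ) else 0) - π₁| ≤ ε)
    (hq1 : (sampleMean fun i => if Y i = 1 then (1 : ℝ) else 0) ≤ 1)
    (hq0 : 0 ≤ sampleMean fun i => if Y i = 1 then (1 : ℝ) else 0)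
    (hεD : ε ≤ D) (hd : |d| ≤ C) (hf : |sampleMean f + π₂ * d| ≤ D)
    (hv : |sampleMean fun i => if Y i = 1 then f i else 0| ≤ D) :
    |sampleCov f Y - 2 * π₁ * π₂ * d| ≤ (4 + 2 * C) * D := by
  have h := abs_mean_plus_sub_le hπ hπ₂ hπ₁ hq hq1 hq0 hεD hd hf hv
  rw [sampleCov_label hn hY]
  rw [abs_le] at *
  constructor <;> linarith [h.1, h.2]

lemma abs_sampleCov_centeredLabels_sub_le (hn : 0 < n) (hY : ∀ i, Y i = 1 ∨ Y i = -1)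
    {c : ℝ} (hc : 0 < c)
    (hπ : π₁ + π₂ = 1) (hπ₂ : 0 ≤ π₂) (hπ₁ : 0 ≤ π₁)
    (hq : |(sampleMean fun i => if Y i = 1 then (1 : ℝ) else 0) - π₁| ≤ ε)
    (hq1 : c / 2 ≤ 1 - (sampleMean fun i => if Y i = 1 then (1 : ℝ) else 0))
    (hq0 : c / 2 ≤ sampleMean fun i => if Y i = 1 then (1 : ℝ) else 0)
    (hεD : ε ≤ D) (hd : |d| ≤ C) (hf : |sampleMean f + π₂ * d| ≤ D)
    (hv : |sampleMean fun i => if Y i = 1 then f i else 0| ≤ D) :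
    |sampleCov f (centeredLabels Y) - d| ≤ 8 * (1 + C) / c ^ 2 * D := by
  have h := abs_mean_plus_sub_le hπ hπ₂ hπ₁ hq (by linarith) (by linarith) hεD hd hf hv
  rw [sampleCov_centeredLabels hn hY (by linarith) (by linarith)]
  set q := sampleMean fun i => if Y i = 1 then (1 : ℝ) else 0
  set v := sampleMean fun i => if Y i = 1 then f i else 0
  have hD0 : 0 ≤ D := (abs_nonneg _).trans hf
  have hC0 : 0 ≤ C := (abs_nonneg _).trans hd
  have hqq : c ^ 2 / 4 ≤ q * (1 - q) := by
    have := mul_le_mul hq0 hq1 (by positivity) (by linarith)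
    linarith [this, (by ring : c / 2 * (c / 2) = c ^ 2 / 4)]
  have hqpos : 0 < q * (1 - q) := lt_of_lt_of_le (by positivity) hqq
  -- The second term accounts for normalizing by `q (1 - q)` instead of `π₁ π₂`.
  have e : (v - sampleMean f * q) / (q * (1 - q)) - d =
      ((v - sampleMean f * q - π₁ * π₂ * d) - (q - π₁) * ((1 - q - π₁) * d)) / (q * (1 - q)) := by
    have : π₂ = 1 - π₁ := by linarith
    rw [this, div_sub' hqpos.ne']
    congr 1; ring
  have h2 : |(q - π₁) * ((1 - q - π₁) * d)| ≤ D * (1 * C) := by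
    rw [abs_mul, abs_mul]
    refine mul_le_mul (hq.trans hεD) (mul_le_mul ?_ hd (abs_nonneg _) zero_le_one)
      (by positivity) hD0
    rw [abs_le]; constructor <;> linarith
  rw [e, abs_div, abs_of_pos hqpos, div_le_iff₀ hqpos]
  have h3 := (abs_sub _ _).trans (add_le_add h h2)
  refine h3.trans ?_
  have h4 : 8 * (1 + C) / c ^ 2 * D * (c ^ 2 / 4) ≤ 8 * (1 + C) / c ^ 2 * D * (q * (1 - q)) :=
    mul_le_mul_of_nonneg_left hqq (by positivity)
  refine le_trans (le_of_eq ?_) h4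
  field_simp; ring

end Labels

/-! ### Uniform covariance bounds with high probability -/

namespace SeLDAModel

variable {n p : ℕ} (M : SeLDAModel p)

/-- All entries of the sample covariances are within `t` of the population values. -/
def CovarianceBounds (X : Fin n → Fin p → ℝ) (Y : Fin n → ℝ) (t : ℝ) : Prop :=
  (∀ j k, |sampleCov (fun i => hHat X Y j (X i j)) (fun i => hHat X Y k (X i k)) - M.Omega j k|
    ≤ t) ∧
  (∀ j, |sampleCov (fun i => hHat X Y j (X i j)) (centeredLabels Y) - M.delta j| ≤ t) ∧
  ∀ j, |sampleCov (fun i => hHat X Y j (X i j)) Y - 2 * M.piPlus * M.piMinus * M.delta j| ≤ t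

/-- The sample-wise half of the argument: on the event that finitely many averages of the true
scores deviate little, all estimated covariances are accurate. Here `θ` is the bulk error, `τ` the
Gaussian tail and `ε` the Hoeffding deviation. -/
lemma covarianceBounds_of_deviations (hn : 0 < n) {X z : Fin n → Fin p → ℝ} {Y : Fin n → ℝ}
    (hord : ∀ i i' j, X i' j ≤ X i j ↔ z i' j ≤ z i j) (hY : ∀ i, Y i = 1 ∨ Y i = -1)
    {c C ε B θ H τ : ℝ} (hc : 0 < c) (hpi : c ≤ M.piPlus ∧ c ≤ M.piMinus)
    (hC : ∀ j, |M.delta j| ≤ C) (hC0 : 0 ≤ C) (hB : 1 ≤ B) (hBH : B ≤ H) (hθ1 : θ ≤ 1)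
    (hθn : 1 / n ≤ θ) (hBn : B + 1 ≤ n) (hε : 0 ≤ ε) (hεc : ε ≤ c / 2) (hcn : 4 ≤ c * n)
    (hmain : 4 * ε / c + 4 / (c * n) ^ 2 < (θ - 1 / n) * (Real.exp (-(B + 1) ^ 2 / 2) / 3))
    (hHn : Real.exp (-H ^ 2 / 2) < 1 / (n : ℝ) ^ 2) (hτ : 0 ≤ τ)
    (hD : 6 * H ^ 2 * (θ + τ + ε) ≤ 1)
    (hq : |(sampleMean fun i => if Y i = 1 then (1 : ℝ) else 0) - M.piPlus| ≤ ε)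
    (hgrid : ∀ (j : Fin p) (m : ℤ), |m| ≤ (n : ℤ) ^ 2 →
      |(sampleMean fun i => if Y i = 1 ∧ z i j ≤ m / n then (1 : ℝ) else 0) -
        M.piPlus * cdf (gaussianReal 0 1) (m / n)| ≤ ε)
    (htail : ∀ j, (sampleMean fun i => if B < |z i j| then (1 : ℝ) else 0) ≤ τ + ε)
    (hmean : ∀ j, |(sampleMean fun i => clip B (z i j)) + M.piMinus * M.delta j| ≤ B * ε + τ)
    (hplus : ∀ j, |sampleMean fun i => if Y i = 1 then clip B (z i j) else 0| ≤ B * ε + τ)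
    (hprod : ∀ j k, |(sampleMean fun i => clip B (z i j) * clip B (z i k)) -
      (M.Omega j k + M.piMinus * M.delta j * (M.piMinus * M.delta k))| ≤ B ^ 2 * ε + 2 * τ) :
    M.CovarianceBounds X Y (8 * (1 + C) / c ^ 2 * (6 * H ^ 2 * (θ + τ + ε))) := by
  have hn' : (0 : ℝ) < n := by positivity
  have hB0 : 0 ≤ B := by linarith
  have hH1 : 1 ≤ H := by linarith
  have hθ0 : 0 ≤ θ := le_trans (by positivity) hθn
  have hπ := M.piPlus_add_piMinus
  set q := sampleMean fun i => if Y i = 1 then (1 : ℝ) else 0 with hqdef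
  have hq' := abs_le.1 hq
  have hq0 : c / 2 ≤ q := by linarith [hpi.1]
  have hq1 : c / 2 ≤ 1 - q := by linarith [hpi.2]
  have hNq : (nPlus Y : ℝ) = n * q := nPlus_eq_mul_sampleMean hn
  have hN2 : 2 ≤ nPlus Y := by
    have : (2 : ℝ) ≤ nPlus Y := by
      rw [hNq]; linarith [mul_le_mul_of_nonneg_left hq0 hn'.le]
    exact_mod_cast this
  have hNpos : (0 : ℝ) < nPlus Y := by exact_mod_cast (by omega : 0 < nPlus Y)
  have hNn : (nPlus Y : ℝ) ≤ n := by
    rw [hNq]; linarith [mul_le_mul_of_nonneg_left (by linarith : q ≤ 1) hn'.le]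
  have hHN : Real.exp (-H ^ 2 / 2) < 1 / (nPlus Y : ℝ) ^ 2 :=
    hHn.trans_le (one_div_le_one_div_of_le (by positivity) (pow_le_pow_left₀ hNpos.le hNn 2))
  set x : Fin n → Fin p → ℝ := fun i j => hHat X Y j (X i j) with hxdef
  have hx : ∀ i j, |x i j| ≤ H := fun i j => abs_hHat_le hN2 (by linarith) hHN j _
  have hxz : ∀ i j, |z i j| ≤ B → |x i j - z i j| ≤ θ := fun i j hz =>
    abs_hHat_sub_le hn hord hc hε hq0 hq hgrid hBn hθ1 hθn hmain i j hz
  set e1 := θ + 2 * H * (τ + ε) with he1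
  set D := 6 * H ^ 2 * (θ + τ + ε) with hDdef
  have hHH : H ≤ H ^ 2 := le_self_pow₀ hH1 two_ne_zero
  have hBB : B ^ 2 ≤ H ^ 2 := pow_le_pow_left₀ hB0 hBH 2
  -- As `1 ≤ B ≤ H`, the factor `H ^ 2` dominates every factor in front of the three errors; the `6`
  -- in `D` leaves room for the sums.
  have hsm : ∀ a : ℝ, 0 ≤ a → H * a ≤ H ^ 2 * a ∧ B * a ≤ H ^ 2 * a ∧ a ≤ H ^ 2 * a ∧
      B ^ 2 * a ≤ H ^ 2 * a := fun a ha =>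
    ⟨mul_le_mul_of_nonneg_right hHH ha, mul_le_mul_of_nonneg_right (by linarith) ha,
      le_mul_of_one_le_left ha (by linarith), mul_le_mul_of_nonneg_right hBB ha⟩
  obtain ⟨t1, t2, t3, t4⟩ := hsm θ hθ0
  obtain ⟨u1, u2, u3, u4⟩ := hsm τ hτ
  obtain ⟨v1, v2, v3, v4⟩ := hsm ε hε
  have hDe : D = 6 * (H ^ 2 * θ) + 6 * (H ^ 2 * τ) + 6 * (H ^ 2 * ε) := by rw [hDdef]; ring
  have hεD : ε ≤ D := by linarith
  have hkey := fun j {w : Fin n → ℝ} {a : ℝ} => abs_sampleMean_mul_sub_clip_le (w := w) (a := a)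
    hn hBH hB0 hθ0 (fun i => hx i j) (fun i => hxz i j) (htail j)
  have k1 : ∀ j, |(sampleMean fun i => x i j) + M.piMinus * M.delta j| ≤ D := by
    intro j
    have h := hkey j (w := fun _ => 1) zero_le_one fun i => by simp
    simp only [one_mul] at h
    have h2 := hmean j
    rw [abs_le] at *
    constructor <;> linarith [h.1, h.2, h2.1, h2.2]
  have k2 : ∀ j, |sampleMean fun i => if Y i = 1 then x i j else 0| ≤ D := by
    intro j
    have h := hkey j (w := fun i => if Y i = 1 then 1 else 0) zero_le_one fun i => by
      split_ifs <;> simp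
    simp only [ite_mul, one_mul, zero_mul] at h
    have h2 := hplus j
    rw [abs_le] at *
    constructor <;> linarith [h.1, h.2, h2.1, h2.2]
  -- Replace the estimated scores by clipped true scores one factor at a time, the other factor
  -- being bounded by `H`.
  have k3 : ∀ j k, |(sampleMean fun i => x i j * x i k) -
      (M.Omega j k + M.piMinus * M.delta j * (M.piMinus * M.delta k))| ≤ D := by
    intro j k
    have h1 := hkey k (w := fun i => x i j) (a := H) (by linarith) fun i => hx i j
    have h2 := hkey j (w := fun i => clip B (z i k)) (a := H) (by linarith)
      fun i => (abs_clip_le hB0 _).trans hBH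
    have e2 : (fun i => clip B (z i k) * x i j) = fun i => x i j * clip B (z i k) := by
      funext i; ring
    have e3 : (fun i => clip B (z i k) * clip B (z i j)) =
        fun i => clip B (z i j) * clip B (z i k) := by
      funext i; ring
    rw [e2, e3] at h2
    have h3 := hprod j k
    have e4 : H * (θ + 2 * H * (τ + ε)) = H * θ + 2 * (H ^ 2 * τ) + 2 * (H ^ 2 * ε) := by ring
    rw [e4] at h1 h2
    rw [abs_le] at *
    constructor <;> linarith [h1.1, h1.2, h2.1, h2.2, h3.1, h3.2]
  have hD0 : 0 ≤ D := (hε.trans hεD)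
  have hpd : ∀ j, |M.piMinus * M.delta j| ≤ C := by
    intro j
    rw [abs_mul, abs_of_nonneg M.piMinus_nonneg]
    have := mul_le_mul (by linarith [M.piPlus_nonneg] : M.piMinus ≤ 1) (hC j) (abs_nonneg _)
      zero_le_one
    linarith
  have hc1 : c ^ 2 ≤ 1 := by
    have : c ≤ 1 := by linarith [hpi.1, M.piMinus_nonneg]
    exact pow_le_one₀ hc.le this
  have hK : 8 * (1 + C) ≤ 8 * (1 + C) / c ^ 2 := by
    rw [le_div_iff₀ (by positivity)]; exact mul_le_of_le_one_right (by linarith) hc1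
  refine ⟨fun j k => ?_, fun j => ?_, fun j => ?_⟩
  · refine (abs_sampleCov_sub_le (f := fun i => x i j) (g := fun i => x i k) hD (hpd k) (hpd j)
      (k1 j) (k1 k) (k3 j k)).trans (mul_le_mul_of_nonneg_right (by linarith) hD0)
  · exact abs_sampleCov_centeredLabels_sub_le (f := fun i => x i j) hn hY hc hπ M.piMinus_nonneg
      M.piPlus_nonneg hq hq1 hq0 hεD (hC j) (k1 j) (k2 j)
  · exact (abs_sampleCov_label_sub_le (f := fun i => x i j) hn hY hπ M.piMinus_nonneg
      M.piPlus_nonneg hq (by linarith) (by linarith) hεD (hC j) (k1 j) (k2 j)).trans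
      (mul_le_mul_of_nonneg_right (by linarith) hD0)

end SeLDAModel

namespace SeLDAModel

variable {n p : ℕ} (M : SeLDAModel p)

/-- The `h_j` are only almost everywhere measurable under the law, whereas the Hoeffding bounds are
applied to measurable functions. -/
lemma exists_measurable_scores : ∃ Z : (Fin p → ℝ) × ℝ → Fin p → ℝ,
    (∀ j, Measurable fun w => Z w j) ∧
    ∀ᵐ w ∂M.law, ∀ j, Z w j = M.h j (w.1 j) := by
  refine ⟨fun w j => (M.aemeasurable_h j).mk _ w, fun j => (M.aemeasurable_h j).measurable_mk, ?_⟩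
  rw [ae_all_iff]
  exact fun j => (M.aemeasurable_h j).ae_eq_mk.symm

/-- With high probability the sample covariances of the estimated scores are uniformly close to the
population values. -/
lemma measureReal_not_covarianceBounds_le (hn : 0 < n) {S : Type*} [MeasurableSpace S]
    {P : Measure S} [IsProbabilityMeasure P] {X : Fin n → S → Fin p → ℝ} {Y : Fin n → S → ℝ}
    (hlaw : ∀ i, HasLaw (fun ω => (X i ω, Y i ω)) M.law P)
    (hindep : iIndepFun (fun i ω => (X i ω, Y i ω)) P)
    {c C ε B θ H : ℝ} (hc : 0 < c) (hpi : c ≤ M.piPlus ∧ c ≤ M.piMinus)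
    (hC : ∀ j, |M.delta j| ≤ C) (hC0 : 0 ≤ C) (hB : 1 ≤ B) (hBH : B ≤ H) (hθ1 : θ ≤ 1)
    (hθn : 1 / n ≤ θ) (hBn : B + 1 ≤ n) (hε : 0 ≤ ε) (hεc : ε ≤ c / 2) (hcn : 4 ≤ c * n)
    (hmain : 4 * ε / c + 4 / (c * n) ^ 2 < (θ - 1 / n) * (Real.exp (-(B + 1) ^ 2 / 2) / 3))
    (hHn : Real.exp (-H ^ 2 / 2) < 1 / (n : ℝ) ^ 2)
    (hD : 6 * H ^ 2 * (θ + tailBound C B + ε) ≤ 1) :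
    P.real {ω | ¬ M.CovarianceBounds (fun i => X i ω) (fun i => Y i ω)
        (8 * (1 + C) / c ^ 2 * (6 * H ^ 2 * (θ + tailBound C B + ε)))} ≤
      (1 + p * (2 * (n : ℝ) ^ 2 + 1) + 3 * p + (p : ℝ) ^ 2) *
        (2 * Real.exp (-(n * ε ^ 2) / 2)) := by
  classical
  have := M.isProb
  obtain ⟨Z, hZm, hZ⟩ := M.exists_measurable_scores
  have hB0 : 0 < B := by linarith
  choose T _ hT hmono using M.strictMono_h
  obtain ⟨Γ, hΓ, hΓc⟩ : ∃ Γ : Finset ℤ, (∀ m, |m| ≤ (n : ℤ) ^ 2 → m ∈ Γ) ∧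
      Γ.card = 2 * n ^ 2 + 1 := by
    refine ⟨Finset.Icc (-(n : ℤ) ^ 2) ((n : ℤ) ^ 2), fun m hm => Finset.mem_Icc.2
      ⟨by linarith [(abs_le.1 hm).1], (abs_le.1 hm).2⟩, ?_⟩
    rw [Int.card_Icc]
    have : (n : ℤ) ^ 2 + 1 - -(n : ℤ) ^ 2 = ((2 * n ^ 2 + 1 : ℕ) : ℤ) := by push_cast; ring
    rw [this, Int.toNat_natCast]
  -- All averages to be controlled by one union bound: class frequency, class-`1` CDFs on the grid,
  -- tail frequencies, clipped means (overall and restricted to the class `1`), clipped products.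
  set ι := Unit ⊕ (Fin p × Γ) ⊕ Fin p ⊕ Fin p ⊕
    Fin p ⊕ (Fin p × Fin p) with hι
  set g : ι → (Fin p → ℝ) × ℝ → ℝ := fun a w => match a with
    | .inl _ => if w.2 = 1 then 1 else 0
    | .inr (.inl (j, m)) => if w.2 = 1 ∧ Z w j ≤ (m : ℤ) / n then 1 else 0
    | .inr (.inr (.inl j)) => if B < |Z w j| then 1 else 0
    | .inr (.inr (.inr (.inl j))) => clip B (Z w j)
    | .inr (.inr (.inr (.inr (.inl j)))) => if w.2 = 1 then clip B (Z w j) else 0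
    | .inr (.inr (.inr (.inr (.inr (j, k))))) => clip B (Z w j) * clip B (Z w k) with hg
  set b : ι → ℝ := fun a => match a with
    | .inl _ => 1
    | .inr (.inl _) => 1
    | .inr (.inr (.inl _)) => 1
    | .inr (.inr (.inr (.inl _))) => B
    | .inr (.inr (.inr (.inr (.inl _)))) => B
    | .inr (.inr (.inr (.inr (.inr _)))) => B ^ 2 with hb
  have hcm : ∀ j, Measurable fun w => clip B (Z w j) := fun j => (measurable_clip B).comp (hZm j)
  have hgm : ∀ a, Measurable (g a) := by
    rintro (_ | ⟨j, m⟩ | j | j | j | ⟨j, k⟩)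
    · exact Measurable.ite (measurableSet_label 1) measurable_const measurable_const
    · exact Measurable.ite
        ((measurableSet_label 1).inter (measurableSet_le (hZm j) measurable_const))
        measurable_const measurable_const
    · exact Measurable.ite (measurableSet_lt measurable_const (hZm j).abs)
        measurable_const measurable_const
    · exact hcm j
    · exact Measurable.ite (measurableSet_label 1) (hcm j) measurable_const
    · exact (hcm j).mul (hcm k)
  have hbpos : ∀ a, 0 < b a := by
    rintro (_ | ⟨j, m⟩ | j | j | j | ⟨j, k⟩) <;> simp only [hb] <;> positivity
  have hgb : ∀ a w, |g a w| ≤ b a := by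
    rintro (_ | ⟨j, m⟩ | j | j | j | ⟨j, k⟩) w <;> simp only [hg, hb]
    · split_ifs <;> simp
    · split_ifs <;> simp
    · split_ifs <;> simp
    · exact abs_clip_le hB0.le _
    · split_ifs
      · exact abs_clip_le hB0.le _
      · simpa using hB0.le
    · rw [abs_mul, sq]
      exact mul_le_mul (abs_clip_le hB0.le _) (abs_clip_le hB0.le _) (abs_nonneg _) hB0.le
  have hcard : (Fintype.card ι : ℝ) = 1 + p * (2 * (n : ℝ) ^ 2 + 1) + 3 * p + (p : ℝ) ^ 2 := by
    simp only [hι, Fintype.card_sum, Fintype.card_prod, Fintype.card_coe, hΓc, Fintype.card_fin,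
      Fintype.card_unit]
    push_cast; ring
  have hprob := measureReal_exists_abs_sampleMean_sub_ge hn hlaw hindep hbpos hgm hgb hε
  rw [hcard] at hprob
  refine le_trans ?_ hprob
  have hae : ∀ᵐ ω ∂P, ∀ i, (Y i ω = 1 ∨ Y i ω = -1) ∧
      (∀ j, Z (X i ω, Y i ω) j = M.h j (X i ω j)) ∧
      ∀ j, X i ω j ∈ T j := by
    rw [ae_all_iff]
    intro i
    have h : ∀ᵐ w ∂M.law, (w.2 = 1 ∨ w.2 = -1) ∧ (∀ j, Z w j = M.h j (w.1 j)) ∧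
        ∀ j, w.1 j ∈ T j := by
      filter_upwards [M.label, hZ, ae_all_iff.2 hT]
        with w h1 h2 h3 using ⟨h1, h2, h3⟩
    rw [← (hlaw i).map_eq] at h
    exact ae_of_ae_map (hlaw i).aemeasurable h
  -- Labels, scores and carrying sets are as prescribed only almost surely, so the events are
  -- compared up to a null set.
  refine ENNReal.toReal_mono (measure_ne_top _ _) (measure_mono_ae ?_)
  filter_upwards [hae] with ω hω hbad
  by_contra hno
  apply hbad
  have hdev : ∀ a, |sampleMean (fun i => g a (X i ω, Y i ω)) - ∫ w, g a w ∂M.law| ≤ b a * ε := by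
    intro a
    by_contra h
    exact hno ⟨a, (not_le.1 h).le⟩
  have hτ : 0 ≤ tailBound C B := by unfold tailBound; positivity
  refine M.covarianceBounds_of_deviations hn (z := fun i => Z (X i ω, Y i ω)) ?_
    (fun i => (hω i).1) hc hpi hC hC0 hB hBH hθ1 hθn hBn hε hεc hcn hmain hHn hτ hD
    ?_ ?_ ?_ ?_ ?_ ?_
  -- Strict monotonicity of `h j` on the carrying set makes scores and features equally ordered.
  · intro i i' j
    rw [(hω i).2.1 j, (hω i').2.1 j]
    exact ((hmono j).le_iff_le ((hω i').2.2 j) ((hω i).2.2 j)).symm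
  · have h := hdev (.inl ())
    have e : ∫ w, g (.inl ()) w ∂M.law = M.piPlus := M.integral_plus
    rw [e] at h
    simpa only [hg, hb, one_mul] using h
  · intro j m hm
    have h := hdev (.inr (.inl (j, ⟨m, hΓ m hm⟩)))
    have e : ∫ w, g (.inr (.inl (j, ⟨m, hΓ m hm⟩))) w ∂M.law =
        M.piPlus * cdf (gaussianReal 0 1) (m / n) := by
      rw [← M.integral_plus_le j]
      apply integral_congr_ae
      filter_upwards [hZ] with w hw
      simp only [hg, hw]
    rw [e] at h
    simpa only [hg, hb, one_mul] using h
  · intro j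
    have h := hdev (.inr (.inr (.inl j)))
    have e : ∫ w, g (.inr (.inr (.inl j))) w ∂M.law ≤ tailBound C B := by
      refine le_trans (le_of_eq ?_) (M.integral_tail_le hB (hC j))
      apply integral_congr_ae
      filter_upwards [hZ] with w hw
      simp only [hg, hw]
    have h' := (abs_le.1 h).2
    simp only [hb, one_mul] at h'
    have h2 : (sampleMean fun i => if B < |Z (X i ω, Y i ω) j| then (1 : ℝ) else 0) =
      sampleMean (fun i => g (.inr (.inr (.inl j))) (X i ω, Y i ω)) := rfl
    rw [h2]; linarith
  · intro j
    have h := hdev (.inr (.inr (.inr (.inl j))))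
    have e : ∫ w, g (.inr (.inr (.inr (.inl j)))) w ∂M.law =
        ∫ w, clip B (M.h j (w.1 j)) ∂M.law := by
      apply integral_congr_ae
      filter_upwards [hZ] with w hw
      simp only [hg, hw]
    rw [e] at h
    have h2 := M.abs_integral_clip_add_le hB (hC j)
    simp only [hg, hb] at h
    rw [abs_le] at *
    constructor <;> linarith [h.1, h.2, h2.1, h2.2]
  · intro j
    have h := hdev (.inr (.inr (.inr (.inr (.inl j)))))
    have e : ∫ w, g (.inr (.inr (.inr (.inr (.inl j))))) w ∂M.law =
        ∫ w, (if w.2 = 1 then clip B (M.h j (w.1 j)) else 0) ∂M.law := by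
      apply integral_congr_ae
      filter_upwards [hZ] with w hw
      simp only [hg, hw]
    rw [e] at h
    have h2 := M.abs_integral_plus_clip_le hB (hC j)
    simp only [hg, hb] at h
    rw [abs_le] at *
    constructor <;> linarith [h.1, h.2, h2.1, h2.2]
  · intro j k
    have h := hdev (.inr (.inr (.inr (.inr (.inr (j, k))))))
    have e : ∫ w, g (.inr (.inr (.inr (.inr (.inr (j, k)))))) w ∂M.law =
        ∫ w, clip B (M.h j (w.1 j)) * clip B (M.h k (w.1 k)) ∂M.law := by
      apply integral_congr_ae
      filter_upwards [hZ] with w hw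
      simp only [hg, hw]
    rw [e] at h
    have h2 := M.abs_integral_clip_mul_clip_sub_le hB0.le (hC j) (hC k)
    simp only [hg, hb] at h
    rw [abs_le] at *
    constructor <;> linarith [h.1, h.2, h2.1, h2.2]

end SeLDAModel

/-! ### Support recovery in the model -/

namespace SeLDAModel

variable {n p : ℕ} (M : SeLDAModel p)

/-- Support recovery from entrywise covariance bounds, for a response whose population covariance
with the scores is a multiple of `μ₊ - μ₋`. -/
lemma selected_eq_of_covariance_bounds (hn : 0 < n) (hA : M.A.Nonempty)
    {X : Fin n → Fin p → ℝ} {Y R : Fin n → ℝ} {lam b0 : ℝ} {b : Fin p → ℝ} (hlam : 0 < lam)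
    (h : IsSSDA X Y R lam b0 b) {a a₀ C κ e γ : ℝ} (hC : 0 ≤ C) (ha₀ : a₀ ≤ a) (ha₀' : 0 ≤ a₀)
    (ha1 : a ≤ 1)
    (hphi : M.varphi ≤ C) (hDelta : M.Delta ≤ C) (hκ0 : 0 ≤ κ) (hkappa : M.kappa ≤ κ)
    (he : 0 ≤ e)
    (hG : ∀ j k, |sampleCov (fun i => hHat X Y j (X i j)) (fun i => hHat X Y k (X i k)) -
      M.Omega j k| ≤ e)
    (hd : ∀ j, |sampleCov (fun i => hHat X Y j (X i j)) R - a * M.delta j| ≤ e)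
    (hsmall : (1 + C) * (M.s * e) ≤ γ) (hη : (1 + C * C) * (M.s * e) ≤ γ * lam)
    (hβ : (2 * C + 1) * lam ≤ a₀ * M.minBeta) (hγ : κ + 16 * γ ≤ 1) (hγ0 : 0 < γ) :
    selected b = M.A ∧ ∀ j ∈ M.A, |b j - a * M.betaStar j| ≤ 4 * M.varphi * lam := by
  have ha0 : 0 ≤ a := ha₀'.trans ha₀
  have hs1 : (1 : ℝ) ≤ M.A.card := by exact_mod_cast hA.card_pos
  have hse : 0 ≤ (M.A.card : ℝ) * e := by positivity
  have hese : e ≤ M.A.card * e := le_mul_of_one_le_left he hs1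
  have hph := M.varphi_nonneg
  change (1 + C) * (M.A.card * e) ≤ γ at hsmall
  change (1 + C * C) * (M.A.card * e) ≤ γ * lam at hη
  have hγ1 : γ ≤ 1 / 16 := by linarith
  have hCse : C * (M.A.card * e) ≤ γ := by linarith
  have hη' : e + M.A.card * e * (C * C) ≤ γ * lam := by linarith
  have hq : M.A.card * e * (2 * M.varphi * lam) ≤ 2 * (γ * lam) := by
    have h1 : M.A.card * e * M.varphi ≤ γ := by
      refine le_trans ?_ hCse
      rw [mul_comm]; exact mul_le_mul_of_nonneg_right hphi hse
    have := mul_le_mul_of_nonneg_right h1 hlam.le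
    linarith
  have hγl : 0 < γ * lam := mul_pos hγ0 hlam
  refine h.selected_eq hn hA (Om := M.Omega) (ph := M.varphi) (ka := κ) (ε := e) (m := C * C)
    (β := fun j => a * M.betaStar j) (d := fun j => a * M.delta j) hph he hlam
    M.abs_le_varphi_mul ?_ hG hd ?_ ?_ ?_ ?_ ?_ ?_ ?_
  · intro v t hv ht j hj
    obtain ⟨j0, hj0⟩ := hA
    have ht0 : 0 ≤ t := (abs_nonneg _).trans (ht j0 hj0)
    exact (M.abs_le_kappa_mul v t hv ht j hj).trans (mul_le_mul_of_nonneg_right hkappa ht0)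
  · intro j hj
    simp only [M.betaStar_eq_zero hj, mul_zero]
  · intro j
    rw [← M.sum_Omega_mul_betaStar j, Finset.mul_sum]
    exact Finset.sum_congr rfl fun k _ => by ring
  · intro j hj
    rw [abs_mul, abs_of_nonneg ha0]
    have h1 := M.abs_betaStar_le hj
    have h2 : M.varphi * M.Delta ≤ C * C := mul_le_mul hphi hDelta M.Delta_nonneg hC
    calc a * |M.betaStar j| ≤ 1 * |M.betaStar j| := mul_le_mul_of_nonneg_right ha1 (abs_nonneg _)
      _ ≤ C * C := by linarith
  · have : M.varphi * (M.A.card * e) ≤ C * (M.A.card * e) := mul_le_mul_of_nonneg_right hphi hse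
    linarith
  · have : γ * lam ≤ 1 / 16 * lam := mul_le_mul_of_nonneg_right hγ1 hlam.le
    linarith
  · intro j hj
    rw [abs_mul, abs_of_nonneg ha0]
    have h1 := mul_le_mul ha₀ (M.minBeta_le hj) M.minBeta_nonneg ha0
    have h2 : M.varphi * lam ≤ C * lam := mul_le_mul_of_nonneg_right hphi hlam.le
    have : a₀ * M.minBeta ≤ a * |M.betaStar j| := h1
    linarith
  -- The residual costs at most `γ lam` and the perturbation `2 γ lam`, each entering with weights
  -- `κ` and `1`: in all at most `6 γ lam`, less than the slack `8 γ lam` given by `hγ`.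
  · have h1 : κ * (lam / 2 + (e + M.A.card * e * (C * C)) + M.A.card * e * (2 * M.varphi * lam)) ≤
        κ * (lam / 2 + 3 * (γ * lam)) := mul_le_mul_of_nonneg_left (by linarith) hκ0
    have h2 : κ * (γ * lam) ≤ 1 * (γ * lam) := mul_le_mul_of_nonneg_right (by linarith) hγl.le
    have h3 : (κ + 16 * γ) * lam ≤ 1 * lam := mul_le_mul_of_nonneg_right hγ hlam.le
    linarith

end SeLDAModel

/-! ### Choice of the truncation and deviation levels -/

section Rates

/-- The Hoeffding deviation level. -/
noncomputable def devLevel (n p : ℕ) : ℝ := √(8 * Real.log (p * n) / n)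

/-- The uniform error of the estimated scores on the bulk. -/
noncomputable def bulkError (c : ℝ) (n p : ℕ) : ℝ :=
  49 * Real.exp 2 / c ^ 2 * (devLevel n p * (n : ℝ) ^ (1 / 3 : ℝ))

/-- The truncation level. -/
noncomputable def truncLevel (n : ℕ) : ℝ := √(Real.log n / 2)

/-- The total moment error. -/
noncomputable def totalError (c C : ℝ) (n p : ℕ) : ℝ :=
  6 * (3 * √(Real.log n)) ^ 2 * (bulkError c n p + tailBound C (truncLevel n) + devLevel n p)

lemma exp_neg_log_div {n : ℕ} (hn : 0 < n) (a : ℝ) :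
    Real.exp (-(Real.log n * a)) = (n : ℝ) ^ (-a) := by
  rw [Real.rpow_def_of_pos (by positivity)]; congr 1; ring

lemma tailBound_truncLevel_le {C : ℝ} {n : ℕ} (hn : 0 < n) (hl : 2 ≤ Real.log n) :
    tailBound C (truncLevel n) ≤
      4 * Real.exp (3 * (C + 1) ^ 2 / 2 + C + 1 / 2) * (n : ℝ) ^ (-(1 / 6) : ℝ) := by
  rw [tailBound, mul_assoc, ← exp_neg_log_div hn, ← Real.exp_add]
  apply mul_le_mul_of_nonneg_left _ (by norm_num)
  apply Real.exp_le_exp.2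
  have hB2 : truncLevel n ^ 2 = Real.log n / 2 := Real.sq_sqrt (by linarith)
  -- Writing `B = truncLevel n`: of `-B²/2`, the part `-B²/6` absorbs `(C + 1) B` at cost `3 (C +
  -- 1)² / 2`, and the remaining `-B²/3` is `-(log n) / 6`.
  nlinarith [sq_nonneg (truncLevel n / 3 - (C + 1))]

lemma devLevel_eq {n p : ℕ} (hn : 0 < n) :
    devLevel n p = √8 * √(Real.log (p * n)) * (n : ℝ) ^ (-(1 / 2) : ℝ) := by
  rw [devLevel, Real.sqrt_div' _ (by positivity), Real.sqrt_mul (by norm_num), Real.rpow_neg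
    (by positivity), ← Real.sqrt_eq_rpow, div_eq_mul_inv]

/-- Each of the three errors is at most a constant times `√(log(pn)) n^{-1/6}`. Replacing `log(pn)`
by `L` costs a factor `1 + log n`; with the prefactor `log n` this is at most `n^{ρ/2}`. -/
lemma totalError_le {c C ρ L : ℝ} {n p : ℕ} (hn : 0 < n) (hp0 : 0 < p) (hl : 2 ≤ Real.log n)
    (hlρ : Real.log n ≤ 1 / 2 * (n : ℝ) ^ (ρ / 4)) (hp : 1 ≤ Real.log p) (hL : Real.log p ≤ L) :
    totalError c C n p ≤ 54 * (49 * Real.exp 2 / c ^ 2 * √8 +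
      4 * Real.exp (3 * (C + 1) ^ 2 / 2 + C + 1 / 2) + √8) *
      √(L / (n : ℝ) ^ (1 / 3 - ρ : ℝ)) := by
  have hn0 : (0 : ℝ) < n := by positivity
  have hn1 : (1 : ℝ) ≤ n := by exact_mod_cast hn
  set ℓ := Real.log n with hℓ
  have hΛ : Real.log (p * n) = Real.log p + ℓ :=
    Real.log_mul (by positivity) (by positivity)
  set Λ := Real.log (p * n)
  have hΛ1 : 1 ≤ √Λ := by rw [Real.one_le_sqrt]; linarith
  set N6 := (n : ℝ) ^ (-(1 / 6) : ℝ) with hN6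
  have hN6pos : 0 < N6 := by positivity
  have hdev1 : devLevel n p * (n : ℝ) ^ (1 / 3 : ℝ) = √8 * √Λ * N6 := by
    have e : (-(1 / 2) : ℝ) + 1 / 3 = -(1 / 6) := by norm_num
    rw [devLevel_eq hn, mul_assoc, ← Real.rpow_add hn0, e]
  have hdev2 : devLevel n p ≤ √8 * √Λ * N6 := by
    rw [devLevel_eq hn]
    apply mul_le_mul_of_nonneg_left _ (by positivity)
    exact Real.rpow_le_rpow_of_exponent_le hn1 (by norm_num)
  have htail := tailBound_truncLevel_le (C := C) hn hl
  have htail2 : tailBound C (truncLevel n) ≤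
      4 * Real.exp (3 * (C + 1) ^ 2 / 2 + C + 1 / 2) * (√Λ * N6) := by
    refine htail.trans (mul_le_mul_of_nonneg_left ?_ (by positivity))
    exact le_mul_of_one_le_left hN6pos.le hΛ1
  have hH : 6 * (3 * √ℓ) ^ 2 = 54 * ℓ := by
    rw [mul_pow, Real.sq_sqrt (by linarith)]; ring
  set K := 49 * Real.exp 2 / c ^ 2 * √8 + 4 * Real.exp (3 * (C + 1) ^ 2 / 2 + C + 1 / 2) + √8
    with hK
  have hK0 : 0 ≤ K := by positivity
  have h1 : totalError c C n p ≤ 54 * ℓ * (K * (√Λ * N6)) := by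
    rw [totalError, ← hℓ, hH, bulkError, hdev1]
    apply mul_le_mul_of_nonneg_left _ (by linarith)
    rw [hK]
    linarith
  have hL1 : 1 ≤ L := hp.trans hL
  have hΛL : √Λ ≤ √L * (1 + ℓ) := by
    have : Λ ≤ L * (1 + ℓ) ^ 2 := by
      have h2 : ℓ ≤ L * ℓ := le_mul_of_one_le_left (by linarith) hL1
      have h3 : 0 ≤ L * ℓ ^ 2 := mul_nonneg (by linarith) (sq_nonneg ℓ)
      rw [hΛ]; linarith
    calc √Λ ≤ √(L * (1 + ℓ) ^ 2) := Real.sqrt_le_sqrt this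
      _ = _ := by rw [Real.sqrt_mul (by linarith), Real.sqrt_sq (by linarith)]
  have hpow : ℓ * (1 + ℓ) ≤ (n : ℝ) ^ (ρ / 2) := by
    have h2 : (n : ℝ) ^ (ρ / 2) = (n : ℝ) ^ (ρ / 4) * (n : ℝ) ^ (ρ / 4) := by
      rw [← Real.rpow_add hn0]; congr 1; ring
    rw [h2]
    nlinarith
  have hrate : √(L / (n : ℝ) ^ (1 / 3 - ρ : ℝ)) = √L * ((n : ℝ) ^ (ρ / 2) * N6) := by
    rw [Real.sqrt_div' _ (by positivity), hN6, ← Real.rpow_add hn0, div_eq_mul_inv,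
      Real.sqrt_eq_rpow ((n : ℝ) ^ _), ← Real.rpow_mul hn0.le, ← Real.rpow_neg hn0.le]
    congr 2; ring
  rw [hrate]
  refine h1.trans ?_
  have h3 : ℓ * √Λ ≤ √L * (n : ℝ) ^ (ρ / 2) := by
    calc ℓ * √Λ ≤ ℓ * (√L * (1 + ℓ)) := mul_le_mul_of_nonneg_left hΛL (by linarith)
      _ = √L * (ℓ * (1 + ℓ)) := by ring
      _ ≤ _ := mul_le_mul_of_nonneg_left hpow (Real.sqrt_nonneg _)
  have h4 := mul_le_mul_of_nonneg_left h3 (by positivity : 0 ≤ 54 * K * N6)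
  linarith

end Rates

/-- The deviation level makes each Hoeffding tail `2 (pn)⁻⁴`, while at most `8 (pn)²` averages are
controlled. -/
lemma SeLDAModel.measureReal_not_covarianceBounds_le_div {n p : ℕ} (M : SeLDAModel p)
    {S : Type*} [MeasurableSpace S]
    {P : Measure S} [IsProbabilityMeasure P] {X : Fin n → S → Fin p → ℝ} {Y : Fin n → S → ℝ}
    (hlaw : ∀ i, HasLaw (fun ω => (X i ω, Y i ω)) M.law P)
    (hindep : iIndepFun (fun i ω => (X i ω, Y i ω)) P)
    {c C : ℝ} (hc : 0 < c) (hpi : c ≤ M.piPlus ∧ c ≤ M.piMinus)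
    (hC : ∀ j, |M.delta j| ≤ C) (hC0 : 0 ≤ C) (hn : 0 < n) (hp : 0 < p)
    (hl : 2 ≤ Real.log n) (hcn : 4 ≤ c * n) (hD : totalError c C n p ≤ 1)
    (hDc : totalError c C n p ≤ c / 2) :
    P.real {ω | ¬ M.CovarianceBounds (fun i => X i ω) (fun i => Y i ω)
        (8 * (1 + C) / c ^ 2 * totalError c C n p)} ≤ 16 / n := by
  have hn0 : (0 : ℝ) < n := by positivity
  have hp1 : (1 : ℝ) ≤ p := by exact_mod_cast hp
  have hn1 : (1 : ℝ) ≤ n := by exact_mod_cast hn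
  set ℓ := Real.log n with hℓ
  have hΛ : Real.log (p * n) = Real.log p + ℓ :=
    Real.log_mul (by positivity) (by positivity)
  have hΛ2 : 2 ≤ Real.log (p * n) := by linarith [Real.log_nonneg hp1]
  have hB2 : truncLevel n ^ 2 = ℓ / 2 := Real.sq_sqrt (by linarith)
  have hB1 : 1 ≤ truncLevel n := by rw [truncLevel, Real.one_le_sqrt]; linarith
  have hε0 : 0 ≤ devLevel n p := Real.sqrt_nonneg _
  have hε2 : devLevel n p ^ 2 = 8 * Real.log (p * n) / n :=
    Real.sq_sqrt (by positivity)
  have hεn : 1 / n ≤ devLevel n p := by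
    rw [devLevel]
    apply Real.le_sqrt_of_sq_le
    rw [div_pow, one_pow, div_le_div_iff₀ (by positivity) hn0]
    nlinarith
  have hεpos : 0 < devLevel n p := lt_of_lt_of_le (by positivity) hεn
  have hc1 : c ≤ 1 := by linarith [hpi.1, M.piMinus_nonneg, M.piPlus_add_piMinus]
  have hcc : c ^ 2 ≤ 1 := pow_le_one₀ hc.le hc1
  have hn3 : 1 ≤ (n : ℝ) ^ (1 / 3 : ℝ) := Real.one_le_rpow hn1 (by norm_num)
  have he2 : 1 ≤ Real.exp 2 := Real.one_le_exp (by norm_num)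
  have hK : 2 ≤ 49 * Real.exp 2 / c ^ 2 := by
    rw [le_div_iff₀ (by positivity)]; linarith
  have hθn : 2 * (1 / n) ≤ bulkError c n p := by
    rw [bulkError]
    have : 1 / n ≤ devLevel n p * (n : ℝ) ^ (1 / 3 : ℝ) :=
      hεn.trans (le_mul_of_one_le_right hε0 hn3)
    exact mul_le_mul hK this (by positivity) (by positivity)
  have hinv : (0 : ℝ) < 1 / n := by positivity
  have hτ : 0 ≤ tailBound C (truncLevel n) := by unfold tailBound; positivity
  have hH : 6 * (3 * √ℓ) ^ 2 = 54 * ℓ := by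
    rw [mul_pow, Real.sq_sqrt (by linarith)]; ring
  have hsum : bulkError c n p + tailBound C (truncLevel n) + devLevel n p ≤ totalError c C n p := by
    rw [totalError, ← hℓ, hH]
    exact le_mul_of_one_le_left (by linarith) (by linarith)
  -- Both terms on the left are at most `4 devLevel / c²`. The constant `49 e²` in `bulkError` makes
  -- the right side at least `(49 / 6) devLevel / c²`, just above their sum.
  have hmain : 4 * devLevel n p / c + 4 / (c * n) ^ 2 <
      (bulkError c n p - 1 / n) * (Real.exp (-(truncLevel n + 1) ^ 2 / 2) / 3) := by
    have h1 : 4 * devLevel n p / c ≤ 4 * devLevel n p / c ^ 2 := by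
      apply div_le_div_of_nonneg_left (by positivity) (by positivity)
      nlinarith
    have h2 : 4 / (c * n) ^ 2 ≤ 4 * devLevel n p / c ^ 2 := by
      have e : 4 / (c * n) ^ 2 = 4 * (1 / n * (1 / n)) / c ^ 2 := by field_simp
      rw [e]
      apply div_le_div_of_nonneg_right _ (by positivity)
      apply mul_le_mul_of_nonneg_left _ (by norm_num)
      refine le_trans (mul_le_of_le_one_left hinv.le ?_) hεn
      rw [div_le_one hn0]; exact hn1
    have h3 : Real.exp (-2) * (n : ℝ) ^ (-(1 / 3) : ℝ) ≤
        Real.exp (-(truncLevel n + 1) ^ 2 / 2) := by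
      rw [← exp_neg_log_div hn, ← Real.exp_add]
      apply Real.exp_le_exp.2
      -- With `B = truncLevel n`, `(B + 1)² / 2 ≤ 2 + 2 B² / 3 = 2 + (log n) / 3`, with equality at
      -- `B = 3`.
      nlinarith [sq_nonneg (truncLevel n - 3)]
    have h4 : bulkError c n p / 2 ≤ bulkError c n p - 1 / n := by linarith
    have h5 : bulkError c n p / 2 * (Real.exp (-2) * (n : ℝ) ^ (-(1 / 3) : ℝ) / 3) ≤
        (bulkError c n p - 1 / n) * (Real.exp (-(truncLevel n + 1) ^ 2 / 2) / 3) :=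
      mul_le_mul h4 (by linarith) (by positivity) (by linarith)
    have h6 : bulkError c n p / 2 * (Real.exp (-2) * (n : ℝ) ^ (-(1 / 3) : ℝ) / 3) =
        49 / 6 * (devLevel n p / c ^ 2) := by
      have e1 : Real.exp 2 * Real.exp (-2) = 1 := by rw [← Real.exp_add]; simp
      have e2 : (n : ℝ) ^ (1 / 3 : ℝ) * (n : ℝ) ^ (-(1 / 3) : ℝ) = 1 := by
        rw [← Real.rpow_add hn0]; simp
      rw [bulkError]
      calc _ = 49 / 6 * (devLevel n p / c ^ 2) * (Real.exp 2 * Real.exp (-2)) *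
          ((n : ℝ) ^ (1 / 3 : ℝ) * (n : ℝ) ^ (-(1 / 3) : ℝ)) := by ring
        _ = _ := by rw [e1, e2]; ring
    have h7 : 0 < devLevel n p / c ^ 2 := by positivity
    have e8 : 4 * devLevel n p / c ^ 2 = 4 * (devLevel n p / c ^ 2) := by ring
    rw [e8] at h1 h2
    linarith
  have hln : ℓ ≤ n - 1 := Real.log_le_sub_one_of_pos hn0
  have hBH : truncLevel n ≤ 3 * √ℓ := by
    have h1 : truncLevel n ≤ √ℓ := Real.sqrt_le_sqrt (by linarith)
    linarith [Real.sqrt_nonneg ℓ]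
  have hBn : truncLevel n + 1 ≤ n := by
    have := le_self_pow₀ hB1 two_ne_zero
    linarith
  -- The left side is `n^{-9/2}`.
  have hHn : Real.exp (-(3 * √ℓ) ^ 2 / 2) < 1 / (n : ℝ) ^ 2 := by
    have e : 1 / (n : ℝ) ^ 2 = Real.exp (-(ℓ * 2)) := by
      rw [exp_neg_log_div hn, Real.rpow_neg hn0.le, one_div]; norm_cast
    rw [e, mul_pow, Real.sq_sqrt (by linarith)]
    apply Real.exp_lt_exp.2; linarith
  refine (M.measureReal_not_covarianceBounds_le hn hlaw hindep hc hpi hC hC0 hB1 hBH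
    (θ := bulkError c n p) (by linarith) (by linarith) hBn hε0 (by linarith) hcn hmain hHn
    hD).trans ?_
  have hexp : Real.exp (-(n * devLevel n p ^ 2) / 2) = 1 / ((p : ℝ) * n) ^ 4 := by
    rw [hε2]
    have e : -((n : ℝ) * (8 * Real.log (p * n) / n)) / 2 = -(4 * Real.log (p * n)) := by
      field_simp; ring
    rw [e, Real.exp_neg, one_div]
    congr 1
    rw [show (4 : ℝ) = ((4 : ℕ) : ℝ) by norm_num, Real.exp_nat_mul, Real.exp_log (by positivity)]
  rw [hexp]
  have hx1 : (1 : ℝ) ≤ p * n := one_le_mul_of_one_le_of_one_le hp1 hn1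
  have hcnt : 1 + p * (2 * (n : ℝ) ^ 2 + 1) + 3 * p + (p : ℝ) ^ 2 ≤ 8 * ((p : ℝ) * n) ^ 2 := by
    have hpp : (p : ℝ) ≤ (p : ℝ) ^ 2 := le_self_pow₀ hp1 two_ne_zero
    have hnn : (1 : ℝ) ≤ (n : ℝ) ^ 2 := one_le_pow₀ hn1
    have h1 : (p : ℝ) ^ 2 ≤ (p : ℝ) ^ 2 * (n : ℝ) ^ 2 := le_mul_of_one_le_right (by positivity) hnn
    have h2 : (p : ℝ) * (n : ℝ) ^ 2 ≤ (p : ℝ) ^ 2 * (n : ℝ) ^ 2 :=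
      mul_le_mul_of_nonneg_right hpp (by positivity)
    rw [mul_pow]
    linarith
  calc _ ≤ 8 * ((p : ℝ) * n) ^ 2 * (2 * (1 / ((p : ℝ) * n) ^ 4)) :=
        mul_le_mul_of_nonneg_right hcnt (by positivity)
    _ = 16 / ((p : ℝ) * n) ^ 2 := by field_simp; norm_num
    _ ≤ 16 / n := by
        apply div_le_div_of_nonneg_left (by norm_num) hn0
        calc (n : ℝ) ≤ p * n := le_mul_of_one_le_left hn0.le hp1
          _ ≤ _ := le_self_pow₀ hx1 two_ne_zero

/-! ### Passage to the limit -/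

lemma totalError_nonneg {c C : ℝ} (n p : ℕ) : 0 ≤ totalError c C n p := by
  unfold totalError bulkError tailBound devLevel; positivity

/-- Only monotonicity and subadditivity of outer measure are used, so no event has to be measurable.
This matters because the minimizers are arbitrary selections. -/
lemma tendsto_measure_one_of_real_compl_le {S : ℕ → Type*} [∀ n, MeasurableSpace (S n)]
    (P : ∀ n, Measure (S n)) [∀ n, IsProbabilityMeasure (P n)] (E F : ∀ n, Set (S n))
    (hEF : ∀ᶠ n in atTop, E n ⊆ F n) {r : ℕ → ℝ} (hr : Tendsto r atTop (𝓝 0))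
    (hE : ∀ᶠ n in atTop, (P n).real (E n)ᶜ ≤ r n) :
    Tendsto (fun n => P n (F n)) atTop (𝓝 1) := by
  have h1 : Tendsto (fun n => 1 - ENNReal.ofReal (r n)) atTop (𝓝 1) := by
    have h := ENNReal.Tendsto.sub (tendsto_const_nhds (x := (1 : ENNReal)) (f := atTop))
      (ENNReal.tendsto_ofReal hr) (Or.inl ENNReal.one_ne_top)
    simpa using h
  refine tendsto_of_tendsto_of_tendsto_of_le_of_le' h1 tendsto_const_nhds ?_
    (Filter.Eventually.of_forall fun n => prob_le_one)
  filter_upwards [hEF, hE] with n h2 h3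
  have h4 : P n (E n)ᶜ ≤ ENNReal.ofReal (r n) := by
    rw [← ofReal_measureReal (measure_ne_top _ _)]; exact ENNReal.ofReal_le_ofReal h3
  rw [tsub_le_iff_right]
  calc (1 : ENNReal) = P n Set.univ := measure_univ.symm
    _ = P n (E n ∪ (E n)ᶜ) := by rw [Set.union_compl_self]
    _ ≤ P n (E n) + P n (E n)ᶜ := measure_union_le _ _
    _ ≤ _ := add_le_add (measure_mono h2) h4

theorem theorem3
    -- for each sample size `n`, a sample of `n` independent copies of `(X, Y)` from a SeLDA model
    (p : ℕ → ℕ) (M : ∀ n, SeLDAModel (p n))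
    {S : ℕ → Type*} [∀ n, MeasurableSpace (S n)]
    (P : ∀ n, Measure (S n)) [∀ n, IsProbabilityMeasure (P n)]
    (X : ∀ n, Fin n → S n → (Fin (p n) → ℝ)) (Y : ∀ n, Fin n → S n → ℝ)
    (hlaw : ∀ n i, HasLaw (fun ω => (X n i ω, Y n i ω)) (M n).law (P n))
    (hindep : ∀ n, iIndepFun (fun i ω => (X n i ω, Y n i ω)) (P n))
    -- the Bayes direction is not zero
    (hA : ∀ n, (M n).A.Nonempty)
    -- the class probabilities, `φ`, `Δ` and `κ < 1` are of constant order
    (c : ℝ) (hc : 0 < c) (hpi : ∀ n, c ≤ (M n).piPlus ∧ c ≤ (M n).piMinus)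
    (C : ℝ) (hphi : ∀ n, (M n).varphi ≤ C) (hDelta : ∀ n, (M n).Delta ≤ C)
    (κ : ℝ) (hκ : κ < 1) (hkappa : ∀ n, (M n).kappa ≤ κ)
    -- condition (C1)
    (ρ : ℝ) (hρ0 : 0 < ρ) (hρ : ρ < 1 / 3)
    (hp : Tendsto p atTop atTop)
    (hC1 : Tendsto (fun n : ℕ => ((M n).s : ℝ) ^ 2 * Real.log ((p n : ℝ) * (M n).s) /
      (n : ℝ) ^ (1 / 3 - ρ : ℝ)) atTop (𝓝 0))
    -- condition (C2)
    (hC2 : (fun n : ℕ => max (((M n).s : ℝ) * (n : ℝ) ^ (-ρ / 2 : ℝ))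
        (((M n).s : ℝ) * √(Real.log ((p n : ℝ) * (M n).s) / (n : ℝ) ^ (1 / 3 - ρ : ℝ))))
      =o[atTop] fun n => (M n).minBeta)
    -- the tuning parameter
    (lam : ℕ → ℝ) (hlam_pos : ∀ n, 0 < lam n)
    (hlam_upper : lam =o[atTop] fun n => (M n).minBeta)
    (hlam_lower : (fun n : ℕ => ((M n).s : ℝ) *
        √(Real.log ((p n : ℝ) * (M n).s) / (n : ℝ) ^ (1 / 3 - ρ : ℝ))) =o[atTop] lam) :
    -- lasso with the centered numeric coding of the labels; the target is `β⋆`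
    (∀ (b0 : ∀ n, S n → ℝ) (b : ∀ n, S n → (Fin (p n) → ℝ)),
      (∀ n ω, IsSSDA (fun i => X n i ω) (fun i => Y n i ω) (centeredLabels fun i => Y n i ω)
        (lam n) (b0 n ω) (b n ω)) →
      Tendsto (fun n => P n {ω | selected (b n ω) = (M n).A}) atTop (𝓝 1) ∧
      Tendsto (fun n => P n {ω | ‖fun j : {j // j ∈ (M n).A} => b n ω j - (M n).betaStar j‖
        ≤ 4 * (M n).varphi * lam n}) atTop (𝓝 1)) ∧
    -- lasso with the numeric labels `1` and `-1`; the target is `2 π₊ π₋ β⋆`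
    (∀ (b0 : ∀ n, S n → ℝ) (b : ∀ n, S n → (Fin (p n) → ℝ)),
      (∀ n ω, IsSSDA (fun i => X n i ω) (fun i => Y n i ω) (fun i => Y n i ω)
        (lam n) (b0 n ω) (b n ω)) →
      Tendsto (fun n => P n {ω | selected (b n ω) = (M n).A}) atTop (𝓝 1) ∧
      Tendsto (fun n => P n {ω | ‖fun j : {j // j ∈ (M n).A} =>
        b n ω j - 2 * (M n).piPlus * (M n).piMinus * (M n).betaStar j‖
        ≤ 4 * (M n).varphi * lam n}) atTop (𝓝 1)) := by
  have hC0 : 0 ≤ C := (M 0).varphi_nonneg.trans (hphi 0)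
  set κ' := max κ 0 with hκ'
  have hκ'0 : 0 ≤ κ' := le_max_right _ _
  have hκ'1 : κ' < 1 := max_lt hκ one_pos
  have hδC : ∀ n j, |(M n).delta j| ≤ C := fun n j =>
    ((M n).abs_delta_le ((hkappa n).trans hκ.le) j).trans (hDelta n)
  have hs1 : ∀ n, (1 : ℝ) ≤ (M n).s := fun n => by exact_mod_cast (hA n).card_pos
  set T : ℕ → ℝ := fun n => totalError c C n (p n) with hT
  have hT0 : ∀ n, 0 ≤ T n := fun n => totalError_nonneg n (p n)
  set t : ℕ → ℝ := fun n => √(Real.log ((p n : ℝ) * (M n).s) / (n : ℝ) ^ (1 / 3 - ρ : ℝ)) with ht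
  have ht0 : ∀ n, 0 ≤ t n := fun n => Real.sqrt_nonneg _
  -- The square root of (C1).
  have hst : Tendsto (fun n => ((M n).s : ℝ) * t n) atTop (𝓝 0) := by
    have h := hC1.sqrt
    rw [Real.sqrt_zero] at h
    refine h.congr fun n => ?_
    rw [ht, mul_div_assoc, Real.sqrt_mul (by positivity), Real.sqrt_sq (by positivity)]
  have hlog : Tendsto (fun n : ℕ => Real.log n) atTop atTop :=
    Real.tendsto_log_atTop.comp tendsto_natCast_atTop_atTop
  have hlogp : Tendsto (fun n : ℕ => Real.log (p n)) atTop atTop := hlog.comp hp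
  have hE1 : ∀ᶠ n : ℕ in atTop, 0 < n ∧ 0 < p n ∧ 2 ≤ Real.log n ∧ 4 ≤ c * n := by
    filter_upwards [eventually_gt_atTop 0, hp.eventually_gt_atTop 0, hlog.eventually_ge_atTop 2,
      (tendsto_natCast_atTop_atTop.const_mul_atTop hc).eventually_ge_atTop 4] with n h1 h2 h3 h4
      using ⟨h1, h2, h3, h4⟩
  obtain ⟨K, hK⟩ : ∃ K : ℝ, ∀ᶠ n in atTop, T n ≤ K * t n := by
    refine ⟨54 * (49 * Real.exp 2 / c ^ 2 * √8 +
      4 * Real.exp (3 * (C + 1) ^ 2 / 2 + C + 1 / 2) + √8), ?_⟩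
    have hlr : ∀ᶠ n : ℕ in atTop, Real.log n ≤ 1 / 2 * (n : ℝ) ^ (ρ / 4) := by
      have h := ((isLittleO_log_rpow_atTop (by positivity : 0 < ρ / 4)).comp_tendsto
        tendsto_natCast_atTop_atTop).def (by norm_num : (0 : ℝ) < 1 / 2)
      filter_upwards [h] with n h
      refine (le_abs_self _).trans (h.trans (le_of_eq ?_))
      rw [Function.comp, Real.norm_of_nonneg (by positivity)]
    filter_upwards [hE1, hlr, hlogp.eventually_ge_atTop 1] with n ⟨h1, h2, h3, _⟩ h4 h5
    refine totalError_le h1 h2 h3 h4 h5 (Real.log_le_log (by positivity) ?_)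
    exact le_mul_of_one_le_right (by positivity) (hs1 n)
  have hKst : ∀ᶠ n in atTop, (M n).s * T n ≤ (|K| + 1) * ((M n).s * t n) := by
    filter_upwards [hK] with n h
    have h1 : T n ≤ (|K| + 1) * t n :=
      h.trans (mul_le_mul_of_nonneg_right (by linarith [le_abs_self K]) (ht0 n))
    have := mul_le_mul_of_nonneg_left h1 (by positivity : (0 : ℝ) ≤ (M n).s)
    linarith
  have hK1 : 0 < |K| + 1 := by positivity
  have hsmall : ∀ δ > 0, ∀ᶠ n in atTop, (M n).s * T n ≤ δ := by
    intro δ hδ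
    filter_upwards [hKst, hst.eventually_le_const (by positivity : 0 < δ / (|K| + 1))] with n h1 h2
    refine h1.trans ?_
    rw [le_div_iff₀ hK1] at h2; linarith
  have hsmall_lam : ∀ δ > 0, ∀ᶠ n in atTop, (M n).s * T n ≤ δ * lam n := by
    intro δ hδ
    filter_upwards [hKst, hlam_lower.def (by positivity : 0 < δ / (|K| + 1))] with n h1 h2
    have h3 : ((M n).s : ℝ) * t n ≤ δ / (|K| + 1) * lam n := by
      rw [Real.norm_of_nonneg (hlam_pos n).le] at h2
      exact (le_abs_self _).trans h2
    refine h1.trans ((mul_le_mul_of_nonneg_left h3 hK1.le).trans (le_of_eq ?_))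
    field_simp
  have hbeta : ∀ᶠ n in atTop, (2 * C + 1) * lam n ≤ c ^ 2 * (M n).minBeta := by
    filter_upwards [hlam_upper.def (by positivity : 0 < c ^ 2 / (2 * C + 1))] with n h
    rw [Real.norm_of_nonneg (hlam_pos n).le,
      Real.norm_of_nonneg (M n).minBeta_nonneg, div_mul_eq_mul_div,
      le_div_iff₀ (by positivity)] at h
    linarith
  set K₀ := 8 * (1 + C) / c ^ 2 with hK₀
  have hK₀pos : 0 < K₀ := by positivity
  set Good : ∀ n, Set (S n) := fun n =>
    {ω | (M n).CovarianceBounds (fun i => X n i ω) (fun i => Y n i ω) (K₀ * T n)} with hGood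
  have hgood : ∀ᶠ n in atTop, (P n).real (Good n)ᶜ ≤ 16 / (n : ℝ) := by
    filter_upwards [hE1, hsmall 1 one_pos, hsmall (c / 2) (by positivity)]
      with n ⟨h1, h2, h3, h4⟩ h5 h6
    have hTs : T n ≤ (M n).s * T n := le_mul_of_one_le_left (hT0 n) (hs1 n)
    exact (M n).measureReal_not_covarianceBounds_le_div (hlaw n) (hindep n) hc (hpi n) (hδC n) hC0
      h1 h2 h3 h4 (hTs.trans h5) (hTs.trans h6)
  have hr : Tendsto (fun n : ℕ => 16 / (n : ℝ)) atTop (𝓝 0) :=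
    tendsto_const_nhds.div_atTop tendsto_natCast_atTop_atTop
  -- Both codings at once: the response enters only through its covariance `a δ` with the scores,
  -- where `a = 1` or `a = 2 π₊ π₋`, and `c ^ 2` is a lower bound for both.
  have key : ∀ (R : ∀ n, S n → Fin n → ℝ) (a : ℕ → ℝ), (∀ n, c ^ 2 ≤ a n) → (∀ n, a n ≤ 1) →
      (∀ n ω, ω ∈ Good n → ∀ j, |sampleCov (fun i => hHat (fun i => X n i ω) (fun i => Y n i ω) j
        (X n i ω j)) (R n ω) - a n * (M n).delta j| ≤ K₀ * T n) →
      ∀ (b0 : ∀ n, S n → ℝ) (b : ∀ n, S n → (Fin (p n) → ℝ)),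
      (∀ n ω, IsSSDA (fun i => X n i ω) (fun i => Y n i ω) (R n ω) (lam n) (b0 n ω) (b n ω)) →
      Tendsto (fun n => P n {ω | selected (b n ω) = (M n).A}) atTop (𝓝 1) ∧
      Tendsto (fun n => P n {ω | ‖fun j : {j // j ∈ (M n).A} =>
        b n ω j - a n * (M n).betaStar j‖ ≤ 4 * (M n).varphi * lam n}) atTop (𝓝 1) := by
    intro R a ha0 ha1 hR b0 b hb
    -- The slack that irrepresentability leaves for estimation errors.
    set γ := (1 - κ') / 16 with hγ
    have hγ0 : 0 < γ := by rw [hγ]; linarith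
    have hall : ∀ᶠ n in atTop, ∀ ω ∈ Good n, selected (b n ω) = (M n).A ∧
        ∀ j ∈ (M n).A, |b n ω j - a n * (M n).betaStar j| ≤ 4 * (M n).varphi * lam n := by
      filter_upwards [hE1, hsmall (γ / ((1 + C) * K₀)) (by positivity),
        hsmall_lam (γ / ((1 + C * C) * K₀)) (by positivity), hbeta]
        with n ⟨h1, _, _, _⟩ h2 h3 h4 ω hω
      refine (M n).selected_eq_of_covariance_bounds h1 (hA n) (hlam_pos n) (hb n ω) hC0 (ha0 n)
        (by positivity) (ha1 n) (hphi n) (hDelta n) hκ'0 ((hkappa n).trans (le_max_left _ _))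
        (mul_nonneg hK₀pos.le (hT0 n)) hω.1 (hR n ω hω) ?_ ?_ h4 (by rw [hγ]; linarith) hγ0
      · rw [le_div_iff₀ (by positivity)] at h2; linarith
      · rw [div_mul_eq_mul_div, le_div_iff₀ (by positivity)] at h3; linarith
    constructor
    · refine tendsto_measure_one_of_real_compl_le P Good _ ?_ hr hgood
      filter_upwards [hall] with n h ω hω using (h ω hω).1
    · refine tendsto_measure_one_of_real_compl_le P Good _ ?_ hr hgood
      filter_upwards [hall] with n h ω hω
      have hnn : 0 ≤ 4 * (M n).varphi * lam n :=
        mul_nonneg (mul_nonneg (by norm_num) (M n).varphi_nonneg) (hlam_pos n).le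
      exact (pi_norm_le_iff_of_nonneg hnn).2 fun j => (h ω hω).2 j j.2
  have hc1 : ∀ n, c ^ 2 ≤ (M n).piPlus * (M n).piMinus := fun n => by
    rw [sq]; exact mul_le_mul (hpi n).1 (hpi n).2 hc.le (M n).piPlus_nonneg
  have hπ1 : ∀ n, 2 * (M n).piPlus * (M n).piMinus ≤ 1 := fun n => by
    have := (M n).piPlus_add_piMinus
    nlinarith [sq_nonneg ((M n).piPlus), sq_nonneg ((M n).piMinus)]
  refine ⟨fun b0 b hb => ?_, fun b0 b hb => ?_⟩
  · have h := key (fun n ω => centeredLabels fun i => Y n i ω) (fun _ => 1)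
      (fun n => by linarith [hc1 n, hπ1 n, sq_nonneg c]) (fun _ => le_rfl)
      (fun n ω hω j => by rw [one_mul]; exact hω.2.1 j) b0 b hb
    simpa only [one_mul] using h
  · exact key (fun n ω i => Y n i ω) (fun n => 2 * (M n).piPlus * (M n).piMinus)
      (fun n => by linarith [hc1 n, sq_nonneg c]) hπ1 (fun n ω hω j => hω.2.2 j) b0 b hb
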